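/- Let $X$ be a complex Banach space, $U$ a (real or complex) Banach space, and let $A$ generate an exponentially stable analytic $C_0$-semigroup $(T(t))_{t\ge 0}$ on $X$. For a fixed $\mu\in\rho(A)$ let $X_{-1}$ be the completion of $X$ in the norm $\|(\mu-A)^{-1}x\|$, and let $(T_{-1}(t))_{t\ge0}$ be the extension of the semigroup to $X_{-1}$. For $\alpha\in[0,1)$ let $X_{-\alpha}\subseteq X_{-1}$ be the completion of $X$ in the norm $\|(-A)^{-\alpha}x\|$, where $(-A)^{-\alpha}=\frac1{\Gamma(\alpha)}\int_0^\infty t^{\alpha-1}T(t)\,dt$ for $\alpha>0$ and $(-A)^{0}=I$. Let $B\in\mathcal L(U,X_{-\alpha})$ for some $\alpha\in[0,1)$, and consider the system $\Sigma(A,B)$: $\dot x=Ax+Bu$, with mild solution $$\phi(t,x,u)=T(t)x+\Phi_t u\in X_{-1},\qquad \Phi_t u=\int_0^t T_{-1}(t-s)Bu(s)\,ds .$$ Then for each integer $n\ge 1$ with $n\alpha<1$ (that is, $n\in[1,1/\alpha)$, with $1/0=\infty$), the function $$V(x)=\int_0^\infty\|T(t)x\|^n\,dt,\qquad x\in X,$$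 is finite, locally Lipschitz continuous, and an $n$-homogeneous non-coercive ISS Lyapunov function in a dissipative form for $\Sigma(A,B)$. The latter means the following: $\Sigma(A,B)$ is $C$-admissible, i.e. $\Phi_\tau u\in X$ for all $\tau>0$ and all continuous $u:[0,\tau]\to U$; $V:X\to[0,\infty)$ is continuous; $V(ax)=|a|^nV(x)$ for all $a\in\mathbb R$, $x\in X$; and there are constants $a_2,a_3,a_4>0$ such that $0<V(x)\le a_2\|x\|^n$ for all $x\in X\setminus\{0\}$ and $$\limsup_{t\downarrow0}\frac{V(\phi(t,x,u))-V(x)}{t}\le -a_3\|x\|^n+a_4\|u(0)\|_U^n$$ for all $x\in X$ and all continuous $u:[0,\infty)\to U$. Moreover, $\Sigma(A,B)$ is $L^q$-$L^q$-ISS for every $q\in[1,\infty)$. This means: for every $t>0$ and $u\in L^q([0,t],U)$ the function $s\mapsto\Phi_su$ takes values in $X$ almost everywhere and belongs to $L^q([0,t],X)$, and there are $\sigma,\gamma\in\mathcal K_\infty$ (continuous, strictly increasing, unbounded functions $[0,\infty)\to[0,\infty)$ vanishing at $0$) such that $$\|\phi(\cdot,x,u)\|_{L^q([0,t],X)}\le\sigma(\|x\|)+\gamma\big(\|u\|_{L^q([0,t],U)}\big)$$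 for all $t\ge0$, $x\in X$ and $u\in L^q([0,t],U)$. -/

import Mathlib

open Set Filter Topology MeasureTheory
open scoped NNReal ENNReal

noncomputable section

/-! ### Strongly continuous semigroups and their generators -/

/-- A `C₀`-semigroup of bounded operators on `X`. Only the operators `toFun t` with `0 ≤ t` matter;
the values at negative times are irrelevant. -/
structure C0Semigroup (X : Type*) [NormedAddCommGroup X] [NormedSpace ℂ X] where
  toFun : ℝ → X →L[ℂ] X
  map_zero' : toFun 0 = ContinuousLinearMap.id ℂ X
  map_add' : ∀ s t : ℝ, 0 ≤ s → 0 ≤ t → toFun (s + t) = (toFun s).comp (toFun t)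
  continuousOn' : ∀ x : X, ContinuousOn (fun t => toFun t x) (Ici 0)

namespace C0Semigroup

variable {X : Type*} [NormedAddCommGroup X] [NormedSpace ℂ X]

instance : CoeFun (C0Semigroup X) (fun _ => ℝ → X →L[ℂ] X) := ⟨C0Semigroup.toFun⟩

/-- There are `M, ω > 0` with `‖T(t)‖ ≤ M e^{-ω t}` for all `t ≥ 0`. -/
def IsExponentiallyStable (S : C0Semigroup X) : Prop :=
  ∃ M ω : ℝ, 0 < M ∧ 0 < ω ∧ ∀ t : ℝ, 0 ≤ t → ‖S t‖ ≤ M * Real.exp (-ω * t)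

end C0Semigroup

/-- The open sector `{z ≠ 0 : |arg z| < θ}`. -/
def openSector (θ : ℝ) : Set ℂ := {z | z ≠ 0 ∧ |z.arg| < θ}

namespace C0Semigroup

variable {X : Type*} [NormedAddCommGroup X] [NormedSpace ℂ X]

/-- The semigroup is analytic: for some `θ ∈ (0, π/2]` it extends to an operator-valued function
on the sector of half-angle `θ` which is holomorphic, satisfies the semigroup law, and is strongly
continuous at `0` in every strictly smaller sector. -/
def IsAnalytic (S : C0Semigroup X) : Prop :=
  ∃ θ : ℝ, 0 < θ ∧ θ ≤ Real.pi / 2 ∧ ∃ F : ℂ → X →L[ℂ] X,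
    (∀ t : ℝ, 0 < t → F (t : ℂ) = S t) ∧
    DifferentiableOn ℂ F (openSector θ) ∧
    (∀ z ∈ openSector θ, ∀ w ∈ openSector θ, F (z + w) = (F z).comp (F w)) ∧
    ∀ θ' : ℝ, 0 < θ' → θ' < θ → ∀ x : X,
      Tendsto (fun z => F z x) (𝓝[openSector θ'] 0) (𝓝 x)

/-- The graph of the generator: all `(x, y)` with `(T(h) x - x) / h → y` as `h ↓ 0`. -/
def generatorGraph (S : C0Semigroup X) : Submodule ℂ (X × X) where
  carrier := {p | Tendsto (fun h : ℝ => h⁻¹ • (S h p.1 - p.1)) (𝓝[>] 0) (𝓝 p.2)}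
  zero_mem' := by simp
  add_mem' := by
    intro p q hp hq
    refine (hp.add hq).congr fun h => ?_
    rw [← smul_add]
    congr 1
    simp only [Prod.fst_add, _root_.map_add]
    abel
  smul_mem' := by
    intro c p hp
    refine (hp.const_smul c).congr fun h => ?_
    rw [smul_comm, smul_sub]
    simp

/-- The generator `A` of the semigroup. -/
def generator (S : C0Semigroup X) : X →ₗ.[ℂ] X := S.generatorGraph.toLinearPMap

theorem generatorGraph_functional (S : C0Semigroup X) (p : X × X) (hp : p ∈ S.generatorGraph)
    (h0 : p.1 = 0) : p.2 = 0 := by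
  have hp' : Tendsto (fun h : ℝ => h⁻¹ • (S h p.1 - p.1)) (𝓝[>] 0) (𝓝 p.2) := hp
  refine tendsto_nhds_unique hp' ?_
  simp [h0]

theorem generator_graph (S : C0Semigroup X) : S.generator.graph = S.generatorGraph :=
  Submodule.toLinearPMap_graph_eq _ S.generatorGraph_functional

theorem generatorGraph_apply (S : C0Semigroup X) {t : ℝ} (ht : 0 ≤ t) {x y : X}
    (h : (x, y) ∈ S.generatorGraph) : (S t x, S t y) ∈ S.generatorGraph := by
  have h' : Tendsto (fun h : ℝ => h⁻¹ • (S h x - x)) (𝓝[>] 0) (𝓝 y) := h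
  change Tendsto (fun h : ℝ => h⁻¹ • (S h (S t x) - S t x)) (𝓝[>] 0) (𝓝 (S t y))
  refine (((S t).continuous.tendsto y).comp h').congr' ?_
  filter_upwards [self_mem_nhdsWithin] with r hr
  have h1 : S r (S t x) = S t (S r x) := by
    have e1 := S.map_add' r t (le_of_lt hr) ht
    have e2 := S.map_add' t r ht (le_of_lt hr)
    rw [add_comm, e2] at e1
    exact (DFunLike.congr_fun e1 x).symm
  have h2 : S t (r⁻¹ • (S r x - x)) = r⁻¹ • S t (S r x - x) :=
    (S t).toLinearMap.map_smul_of_tower r⁻¹ _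
  simp only [Function.comp_apply]
  rw [h2, _root_.map_sub, h1]

end C0Semigroup

/-- `R` is a bounded two-sided inverse of `μ - A : dom A → X`. -/
def IsResolventAt {X : Type*} [NormedAddCommGroup X] [NormedSpace ℂ X]
    (A : X →ₗ.[ℂ] X) (μ : ℂ) (R : X →L[ℂ] X) : Prop :=
  (∀ x : X, ∃ h : R x ∈ A.domain, μ • R x - A ⟨R x, h⟩ = x) ∧
    ∀ x : A.domain, R (μ • (x : X) - A x) = x

/-! ### Completions with respect to a weaker norm -/

/-- A copy of `X`, equipped with the (semi)norm `x ↦ ‖R x‖`, which is a norm for injective `R`. -/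
def Renormed {X : Type*} [NormedAddCommGroup X] [NormedSpace ℂ X] (_R : X →L[ℂ] X) : Type _ := X

namespace Renormed

variable {X : Type*} [NormedAddCommGroup X] [NormedSpace ℂ X] (R : X →L[ℂ] X)

instance : AddCommGroup (Renormed R) := inferInstanceAs (AddCommGroup X)

instance : Module ℂ (Renormed R) := inferInstanceAs (Module ℂ X)

/-- `R`, as a linear map on the renormed copy of `X`. -/
def toBase : Renormed R →ₗ[ℂ] X := R.toLinearMap

instance : SeminormedAddCommGroup (Renormed R) :=
  SeminormedAddCommGroup.induced (Renormed R) X (toBase R)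

instance : NormedSpace ℂ (Renormed R) := NormedSpace.induced ℂ (Renormed R) X (toBase R)

end Renormed

/-- The completion of `X` with respect to the norm `x ↦ ‖R x‖`. -/
def CompletionAlong {X : Type*} [NormedAddCommGroup X] [NormedSpace ℂ X] (R : X →L[ℂ] X) :
    Type _ :=
  UniformSpace.Completion (Renormed R)

namespace CompletionAlong

variable {X : Type*} [NormedAddCommGroup X] [NormedSpace ℂ X] (R : X →L[ℂ] X)

instance : NormedAddCommGroup (CompletionAlong R) :=
  inferInstanceAs (NormedAddCommGroup (UniformSpace.Completion (Renormed R)))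

instance : NormedSpace ℂ (CompletionAlong R) :=
  inferInstanceAs (NormedSpace ℂ (UniformSpace.Completion (Renormed R)))

instance : CompleteSpace (CompletionAlong R) :=
  inferInstanceAs (CompleteSpace (UniformSpace.Completion (Renormed R)))

/-- The canonical map of `X` into its completion. -/
def incl : X →ₗ[ℂ] CompletionAlong R :=
  (UniformSpace.Completion.toComplₗᵢ (𝕜 := ℂ) (E := Renormed R)).toLinearMap

theorem norm_incl (x : X) : ‖incl R x‖ = ‖R x‖ :=
  (UniformSpace.Completion.toComplₗᵢ (𝕜 := ℂ) (E := Renormed R)).norm_map x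

theorem denseRange_incl : DenseRange (incl R) :=
  UniformSpace.Completion.denseRange_coe (α := Renormed R)

end CompletionAlong

namespace C0Semigroup

variable {X : Type*} [NormedAddCommGroup X] [NormedSpace ℂ X]

/-! ### The extrapolation spaces -/

/-- The resolvent set `ρ(A)` of the generator. -/
def resolventSet (S : C0Semigroup X) : Set ℂ :=
  {μ | ∃ R : X →L[ℂ] X, IsResolventAt S.generator μ R}

open scoped Classical in
/-- The resolvent `(μ - A)⁻¹` for `μ ∈ ρ(A)` (and `0` for all other `μ`). -/
def resolvent (S : C0Semigroup X) (μ : ℂ) : X →L[ℂ] X :=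
  if h : ∃ R : X →L[ℂ] X, IsResolventAt S.generator μ R then h.choose else 0

/-- The extrapolation space `X₋₁`: the completion of `X` in the norm `x ↦ ‖(μ - A)⁻¹ x‖`. -/
abbrev Extrapolation (S : C0Semigroup X) (μ : ℂ) : Type _ := CompletionAlong (S.resolvent μ)

theorem resolvent_spec (S : C0Semigroup X) {μ : ℂ} (hμ : μ ∈ S.resolventSet) :
    IsResolventAt S.generator μ (S.resolvent μ) := by
  have h : ∃ R : X →L[ℂ] X, IsResolventAt S.generator μ R := hμ
  rw [resolvent, dif_pos h]
  exact h.choose_spec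

/-- The canonical embedding `X → X₋₁`. -/
abbrev toExtrapolation (S : C0Semigroup X) (μ : ℂ) : X →ₗ[ℂ] S.Extrapolation μ :=
  CompletionAlong.incl (S.resolvent μ)

/-- The operator `T₋₁(t)`: the unique bounded extension of `T(t)` to `X₋₁`. -/
def extrapolated (S : C0Semigroup X) (μ : ℂ) (t : ℝ) :
    S.Extrapolation μ →L[ℂ] S.Extrapolation μ :=
  ((S.toExtrapolation μ).comp (S t).toLinearMap).extendOfNorm (S.toExtrapolation μ)

theorem resolvent_comm (S : C0Semigroup X) {μ : ℂ} (hμ : μ ∈ S.resolventSet) {t : ℝ} (ht : 0 ≤ t)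
    (x : X) : S.resolvent μ (S t x) = S t (S.resolvent μ x) := by
  obtain ⟨h1, h2⟩ := S.resolvent_spec hμ
  obtain ⟨hx, e⟩ := h1 x
  have hg : (S.resolvent μ x, S.generator ⟨_, hx⟩) ∈ S.generatorGraph := by
    rw [← generator_graph]
    exact S.generator.mem_graph ⟨_, hx⟩
  have hg' := S.generatorGraph_apply ht hg
  rw [← generator_graph, LinearPMap.mem_graph_iff] at hg'
  obtain ⟨y, hy1, hy2⟩ := hg'
  simp only at hy1 hy2
  have := h2 y
  rw [hy1, hy2, ← map_smul, ← _root_.map_sub, e] at this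
  exact this

theorem toExtrapolation_injective (S : C0Semigroup X) {μ : ℂ} (hμ : μ ∈ S.resolventSet) :
    Function.Injective (S.toExtrapolation μ) := by
  rw [injective_iff_map_eq_zero]
  intro x hx
  have h0 : S.resolvent μ x = 0 := by
    rw [← norm_eq_zero, ← CompletionAlong.norm_incl, hx, norm_zero]
  obtain ⟨hd, e⟩ := (S.resolvent_spec hμ).1 x
  have hz : (⟨S.resolvent μ x, hd⟩ : S.generator.domain) = 0 := Subtype.ext h0
  rw [hz, h0] at e
  simpa using e.symm

/-- `T₋₁(t)` extends `T(t)`. -/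
theorem extrapolated_toExtrapolation (S : C0Semigroup X) {μ : ℂ} (hμ : μ ∈ S.resolventSet)
    {t : ℝ} (ht : 0 ≤ t) (x : X) :
    S.extrapolated μ t (S.toExtrapolation μ x) = S.toExtrapolation μ (S t x) := by
  refine LinearMap.extendOfNorm_eq (CompletionAlong.denseRange_incl _) ⟨‖S t‖, fun y => ?_⟩ x
  change ‖S.toExtrapolation μ (S t y)‖ ≤ _
  rw [CompletionAlong.norm_incl, CompletionAlong.norm_incl, S.resolvent_comm hμ ht]
  exact (S t).le_opNorm _

/-- The power `(-A)^{-α}`, `α ≥ 0`, of the generator of an exponentially stable analytic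
semigroup: the identity for `α = 0`, and `Γ(α)⁻¹ ∫₀^∞ t^{α-1} T(t) dt` for `α > 0`, an integral
that converges in operator norm. -/
def negFracPow (S : C0Semigroup X) (α : ℝ) : X →L[ℂ] X :=
  if α = 0 then ContinuousLinearMap.id ℂ X
  else (Real.Gamma α)⁻¹ • ∫ t in Ioi (0 : ℝ), (t ^ (α - 1)) • S t

/-- The fractional extrapolation space `X_{-α}`: the completion of `X` in the norm
`x ↦ ‖(-A)^{-α} x‖`. -/
abbrev FracExtrapolation (S : C0Semigroup X) (α : ℝ) : Type _ :=
  CompletionAlong (S.negFracPow α)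

/-- The canonical inclusion `X_{-α} ⊆ X₋₁`, given by its graph. It is the continuous extension of
the identity of `X`, so its graph is the closure of the diagonal `{(x, x) : x ∈ X}` in
`X_{-α} × X₋₁`. -/
def FracInclusion (S : C0Semigroup X) (μ : ℂ) (α : ℝ) (w : S.FracExtrapolation α)
    (z : S.Extrapolation μ) : Prop :=
  (w, z) ∈ closure (range fun x : X =>
    (CompletionAlong.incl (S.negFracPow α) x, S.toExtrapolation μ x))

variable {U : Type*} [NormedAddCommGroup U] [NormedSpace ℝ U]

/-- `B ∈ L(U, X_{-α})`: the operator `B` into `X₋₁` is the composition of a bounded operator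
`U → X_{-α}` with the inclusion `X_{-α} ⊆ X₋₁`. -/
def MapsBoundedlyInto (S : C0Semigroup X) (μ : ℂ) (α : ℝ) (B : U →L[ℝ] S.Extrapolation μ) :
    Prop :=
  ∃ Bα : U →L[ℝ] S.FracExtrapolation α, ∀ v : U, S.FracInclusion μ α (Bα v) (B v)

/-! ### Mild solutions of `x' = A x + B u` -/

/-- `Φ_τ u = ∫₀^τ T₋₁(τ - s) B u(s) ds ∈ X₋₁`. -/
def inputMap (S : C0Semigroup X) (μ : ℂ) (B : U →L[ℝ] S.Extrapolation μ) (u : ℝ → U) (τ : ℝ) :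
    S.Extrapolation μ :=
  ∫ s in (0 : ℝ)..τ, S.extrapolated μ (τ - s) (B (u s))

/-- The mild solution `φ(τ, x, u) = T(τ) x + Φ_τ u ∈ X₋₁`. -/
def mildSolution (S : C0Semigroup X) (μ : ℂ) (B : U →L[ℝ] S.Extrapolation μ) (x : X)
    (u : ℝ → U) (τ : ℝ) : S.Extrapolation μ :=
  S.toExtrapolation μ (S τ x) + S.inputMap μ B u τ

/-- An element of `X₋₁` that lies in `X`, seen as an element of `X` (arbitrary for all other
elements of `X₋₁`). -/
def toState (S : C0Semigroup X) (μ : ℂ) (z : S.Extrapolation μ) : X :=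
  Function.invFun (S.toExtrapolation μ) z

/-- `f ∈ L^q([0, t], X)` for a function `f` with values in `X₋₁`: almost all values lie in `X`, and
they form an `L^q` function. -/
def InLqState (S : C0Semigroup X) (μ : ℂ) (q : ℝ≥0∞) (t : ℝ) (f : ℝ → S.Extrapolation μ) : Prop :=
  (∀ᵐ s ∂(volume.restrict (Icc 0 t)), f s ∈ range (S.toExtrapolation μ)) ∧
    MemLp (fun s => S.toState μ (f s)) q (volume.restrict (Icc 0 t))

/-! ### Admissibility and input-to-state stability -/

/-- `C`-admissibility: `Φ_τ u ∈ X` for every `τ > 0` and every continuous `u : [0, τ] → U`. -/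
def IsCAdmissible (S : C0Semigroup X) (μ : ℂ) (B : U →L[ℝ] S.Extrapolation μ) : Prop :=
  ∀ τ : ℝ, 0 < τ → ∀ u : ℝ → U, ContinuousOn u (Icc 0 τ) →
    S.inputMap μ B u τ ∈ range (S.toExtrapolation μ)

/-- `L^p`-`L^q`-admissibility: `u ∈ L^p([0, t], U)` implies `Φ_(·) u ∈ L^q([0, t], X)`. -/
def IsLpLqAdmissible (S : C0Semigroup X) (μ : ℂ) (B : U →L[ℝ] S.Extrapolation μ)
    (p q : ℝ≥0∞) : Prop :=
  ∀ t : ℝ, 0 < t → ∀ u : ℝ → U, MemLp u p (volume.restrict (Icc 0 t)) →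
    S.InLqState μ q t (S.inputMap μ B u)

end C0Semigroup

/-- Comparison functions of class `K_∞`: continuous, zero at zero, strictly increasing and
unbounded. -/
def IsClassKInfty (γ : ℝ≥0 → ℝ≥0) : Prop :=
  Continuous γ ∧ γ 0 = 0 ∧ StrictMono γ ∧ ¬ BddAbove (range γ)

namespace C0Semigroup

variable {X : Type*} [NormedAddCommGroup X] [NormedSpace ℂ X]
variable {U : Type*} [NormedAddCommGroup U] [NormedSpace ℝ U]

/-- `L^p`-`L^q`-input-to-state stability: the system is `L^p`-`L^q`-admissible and there are
`σ, γ ∈ K_∞` with `‖φ(·, x, u)‖_{L^q([0,t], X)} ≤ σ(‖x‖) + γ(‖u‖_{L^p([0,t], U)})`. -/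
def IsLpLqISS (S : C0Semigroup X) (μ : ℂ) (B : U →L[ℝ] S.Extrapolation μ)
    (p q : ℝ≥0∞) : Prop :=
  S.IsLpLqAdmissible μ B p q ∧
    ∃ σ γ : ℝ≥0 → ℝ≥0, IsClassKInfty σ ∧ IsClassKInfty γ ∧
      ∀ (t : ℝ), 0 ≤ t → ∀ (x : X) (u : ℝ → U), MemLp u p (volume.restrict (Icc 0 t)) →
        S.InLqState μ q t (S.mildSolution μ B x u) ∧
        eLpNorm (fun s => S.toState μ (S.mildSolution μ B x u s)) q (volume.restrict (Icc 0 t)) ≤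
          ((σ ‖x‖₊ + γ (eLpNorm u p (volume.restrict (Icc 0 t))).toNNReal : ℝ≥0) : ℝ≥0∞)

/-! ### Lyapunov functions -/

/-- The Lie derivative `limsup_{t ↓ 0} (V(φ(t, x, u)) - V(x)) / t`, an extended real number. It is
meaningful if `φ(t, x, u)` lies in `X` for all small `t > 0`. -/
def lieDerivative (S : C0Semigroup X) (μ : ℂ) (B : U →L[ℝ] S.Extrapolation μ) (V : X → ℝ)
    (u : ℝ → U) (x : X) : EReal :=
  limsup (fun t : ℝ => (((V (S.toState μ (S.mildSolution μ B x u t)) - V x) / t : ℝ) : EReal))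
    (𝓝[>] 0)

/-- `V` is a `q`-homogeneous non-coercive ISS Lyapunov function in a dissipative form for the
system, the `C`-admissibility of the system being part of the notion. -/
def IsNoncoerciveISSLyapunov (S : C0Semigroup X) (μ : ℂ) (B : U →L[ℝ] S.Extrapolation μ)
    (q : ℝ) (V : X → ℝ) : Prop :=
  S.IsCAdmissible μ B ∧
  Continuous V ∧ (∀ x : X, 0 ≤ V x) ∧
  (∀ (a : ℝ) (x : X), V (a • x) = |a| ^ q * V x) ∧
  ∃ a₂ a₃ a₄ : ℝ, 0 < a₂ ∧ 0 < a₃ ∧ 0 < a₄ ∧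
    (∀ x : X, x ≠ 0 → 0 < V x ∧ V x ≤ a₂ * ‖x‖ ^ q) ∧
    ∀ (x : X) (u : ℝ → U), ContinuousOn u (Ici 0) →
      S.lieDerivative μ B V u x ≤ ((-a₃ * ‖x‖ ^ q + a₄ * ‖u 0‖ ^ q : ℝ) : EReal)

/-- `V(x) = ∫₀^∞ ‖T(t) x‖ⁿ dt`. -/
def orbitIntegral (S : C0Semigroup X) (n : ℕ) (x : X) : ℝ :=
  ∫ t in Ioi (0 : ℝ), ‖S t x‖ ^ n

end C0Semigroup

end

/-!
The proof rests on a kernel representation of the input map: for `t > 0` the operator `T₋₁(t) B`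
takes values in `X`, and `‖T₋₁(t) B‖ ≤ C k(t)` with `k(t) = t ^ (-α) e ^ (-ω t)`, which is integrable
because `α < 1`. Hence `Φ_t u` is the convolution of `u` with an integrable operator kernel.

The kernel bound comes from the smoothing estimate `‖T(t) x‖ ≤ C t ^ (-α) ‖(-A) ^ (-α) x‖`
(`IsAnalytic.exists_norm_apply_le`). The functional calculus of `A` is avoided: for
`y = (-A) ^ (-α) x`, Fubini's theorem and a scaling substitution show that
`∫ s ^ (-α) T'(t + s) y ds` is a nonzero multiple of `T(t) x`, and the Cauchy estimate
`‖T'(r)‖ ≤ C / r` bounds the integral. By density `T(t)` extends to `X_{-α} → X`, and the kernel is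
the composition with `B` (`IsAnalytic.exists_isInputKernel`).

Young's convolution inequality then gives `L^q`-`L^q` input-to-state stability with linear
comparison functions (`IsInputKernel.isLpLqISS`).

For the Lyapunov function `V(x) = ∫ ‖T(t) x‖ ^ n dt`, the free motion satisfies
`V(T(t) x) - V(x) = -∫₀ᵗ ‖T(s) x‖ ^ n ds`, which has slope `-‖x‖ ^ n` at `0`. If `‖u‖ ≤ R` on
`[0, t]`, monotonicity of `k` gives `‖T(s) Φ_t u‖ ≤ t R C k(s)`. Expanding
`(‖T(s) T(t) x‖ + ‖T(s) Φ_t u‖) ^ n` binomially, the `j`-th term is of order `t ^ j ∫ k ^ j`, finite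
for all `j ≤ n` exactly because `n α < 1`; only `j = 1` survives in the Lie derivative, where it is
absorbed by Young's inequality (`IsInputKernel.lieDerivative_le`).
-/

/-! ### Derivative estimates for analytic semigroups -/

theorem isOpen_openSector {θ : ℝ} (hθ : θ ≤ Real.pi) : IsOpen (openSector θ) := by
  rw [isOpen_iff_mem_nhds]
  rintro z ⟨hz, hzθ⟩
  have hs : z ∈ Complex.slitPlane := by
    rw [Complex.mem_slitPlane_iff_arg]
    exact ⟨fun h => by rw [h, abs_of_pos Real.pi_pos] at hzθ; linarith, hz⟩
  have h1 : ∀ᶠ w in 𝓝 z, |w.arg| < θ :=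
    (Complex.continuousAt_arg hs).abs.eventually_lt_const hzθ
  filter_upwards [h1, isOpen_ne.mem_nhds hz] with w h1 h2 using ⟨h2, h1⟩

theorem ofReal_mem_openSector {θ : ℝ} (hθ : 0 < θ) {t : ℝ} (ht : 0 < t) :
    (t : ℂ) ∈ openSector θ := by
  refine ⟨by exact_mod_cast ht.ne', ?_⟩
  rwa [Complex.arg_ofReal_of_nonneg ht.le, abs_zero]

theorem ofReal_mul_mem_openSector {θ : ℝ} {t : ℝ} (ht : 0 < t) {z : ℂ} (hz : z ∈ openSector θ) :
    (t : ℂ) * z ∈ openSector θ := by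
  refine ⟨mul_ne_zero (by exact_mod_cast ht.ne') hz.1, ?_⟩
  rw [Complex.arg_real_mul _ ht]
  exact hz.2

theorem openSector_mono {θ θ' : ℝ} (h : θ' ≤ θ) : openSector θ' ⊆ openSector θ :=
  fun _ hz => ⟨hz.1, hz.2.trans_le h⟩

/-- A sector contains, around each point `t` of the positive half-line, a disc whose radius is a
fixed multiple of `t`. -/
theorem exists_closedBall_subset_openSector {θ : ℝ} (hθ : 0 < θ) (hθ' : θ ≤ Real.pi) :
    ∃ ε : ℝ, 0 < ε ∧ ∀ t : ℝ, 0 < t → Metric.closedBall (t : ℂ) (ε * t) ⊆ openSector θ := by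
  have h1 : ((1 : ℝ) : ℂ) ∈ openSector θ := ofReal_mem_openSector hθ one_pos
  obtain ⟨ε, hε, h⟩ := Metric.nhds_basis_closedBall.mem_iff.1
    ((isOpen_openSector hθ').mem_nhds h1)
  refine ⟨ε, hε, fun t ht z hz => ?_⟩
  have ht' : (t : ℂ) ≠ 0 := by exact_mod_cast ht.ne'
  have h2 : z / t ∈ Metric.closedBall ((1 : ℝ) : ℂ) ε := by
    rw [mem_closedBall_iff_norm] at hz ⊢
    have : z / t - ((1 : ℝ) : ℂ) = (z - t) / t := by
      field_simp
      simp
    rw [this, norm_div, Complex.norm_real, Real.norm_of_nonneg ht.le]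
    exact (div_le_iff₀ ht).2 hz
  have := ofReal_mul_mem_openSector ht (h h2)
  rwa [mul_div_cancel₀ _ ht'] at this

theorem hasDerivAt_comp_ofReal {E : Type*} [NormedAddCommGroup E] [NormedSpace ℂ E] {f : ℂ → E}
    {f' : E} {t : ℝ} (h : HasDerivAt f f' (t : ℂ)) : HasDerivAt (fun r : ℝ => f r) f' t := by
  have := h.scomp t Complex.ofRealCLM.hasDerivAt
  simpa [Function.comp_def] using this

namespace C0Semigroup

variable {X : Type*} [NormedAddCommGroup X] [NormedSpace ℂ X]

theorem apply_zero (S : C0Semigroup X) (x : X) : S 0 x = x := by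
  rw [S.map_zero']; rfl

theorem apply_add (S : C0Semigroup X) {s t : ℝ} (hs : 0 ≤ s) (ht : 0 ≤ t) (x : X) :
    S (s + t) x = S s (S t x) := by
  rw [S.map_add' s t hs ht]; rfl

/-- Near the vertex of a smaller sector the holomorphic extension is bounded in operator norm,
by the uniform boundedness principle. -/
theorem exists_norm_le_of_tendsto [CompleteSpace X] {F : ℂ → X →L[ℂ] X} {s : Set ℂ}
    (hF : ∀ x : X, Tendsto (fun z => F z x) (𝓝[s] 0) (𝓝 x)) :
    ∃ δ C : ℝ, 0 < δ ∧ 0 < C ∧ ∀ z ∈ s, ‖z‖ < δ → ‖F z‖ ≤ C := by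
  by_contra! h
  have h' : ∀ n : ℕ, ∃ z ∈ s, ‖z‖ < 1 / ((n : ℝ) + 1) ∧ (n : ℝ) + 1 < ‖F z‖ := fun n =>
    h (1 / ((n : ℝ) + 1)) ((n : ℝ) + 1) (by positivity) (by positivity)
  choose z hzs hz0 hzF using h'
  have hz : Tendsto z atTop (𝓝[s] 0) := by
    refine tendsto_nhdsWithin_iff.2 ⟨?_, .of_forall hzs⟩
    exact squeeze_zero_norm (fun n => (hz0 n).le) tendsto_one_div_add_atTop_nhds_zero_nat
  obtain ⟨C, hC⟩ := banach_steinhaus (g := fun n => F (z n)) fun x => by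
    obtain ⟨C, hC⟩ := ((hF x).comp hz).norm.bddAbove_range
    exact ⟨C, fun n => hC ⟨n, rfl⟩⟩
  obtain ⟨n, hn⟩ := exists_nat_gt C
  linarith [hC n, hzF n]

variable {S : C0Semigroup X}

theorem IsAnalytic.differentiableAt (h : S.IsAnalytic) {t : ℝ} (ht : 0 < t) :
    DifferentiableAt ℝ S.toFun t := by
  obtain ⟨θ, hθ, hθ', F, hFS, hF, -⟩ := h
  have h1 : DifferentiableAt ℂ F (t : ℂ) :=
    hF.differentiableAt ((isOpen_openSector (hθ'.trans (by linarith [Real.pi_pos]))).mem_nhds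
      (ofReal_mem_openSector hθ ht))
  refine (hasDerivAt_comp_ofReal h1.hasDerivAt).differentiableAt.congr_of_eventuallyEq ?_
  filter_upwards [lt_mem_nhds ht] with r hr using (hFS r hr).symm

theorem IsAnalytic.continuousOn (h : S.IsAnalytic) : ContinuousOn S.toFun (Ioi 0) :=
  fun _ ht => (h.differentiableAt ht).continuousAt.continuousWithinAt

theorem IsAnalytic.deriv_add_left (h : S.IsAnalytic) {s t : ℝ} (hs : 0 ≤ s) (ht : 0 < t) :
    deriv S.toFun (s + t) = (S s).comp (deriv S.toFun t) := by
  have h1 : HasDerivAt (fun r => S (s + r)) (deriv S.toFun (s + t)) t :=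
    (h.differentiableAt (by linarith)).hasDerivAt.comp_const_add s t
  have h2 : HasDerivAt (fun r => (S s).comp (S r)) ((S s).comp (deriv S.toFun t)) t :=
    (((ContinuousLinearMap.compL ℂ X X X) (S s)).restrictScalars ℝ).hasFDerivAt.comp_hasDerivAt t
      (h.differentiableAt ht).hasDerivAt
  refine h1.unique (h2.congr_of_eventuallyEq ?_)
  filter_upwards [lt_mem_nhds ht] with r hr using S.map_add' s r hs hr.le

theorem IsAnalytic.deriv_add_right (h : S.IsAnalytic) {s t : ℝ} (hs : 0 ≤ s) (ht : 0 < t) :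
    deriv S.toFun (t + s) = (deriv S.toFun t).comp (S s) := by
  have h1 : HasDerivAt (fun r => S (r + s)) (deriv S.toFun (t + s)) t :=
    (h.differentiableAt (by linarith)).hasDerivAt.comp_add_const t s
  have h2 : HasDerivAt (fun r => (S r).comp (S s)) ((deriv S.toFun t).comp (S s)) t :=
    (((ContinuousLinearMap.compL ℂ X X X).flip (S s)).restrictScalars
      ℝ).hasFDerivAt.comp_hasDerivAt t (h.differentiableAt ht).hasDerivAt
  refine h1.unique (h2.congr_of_eventuallyEq ?_)
  filter_upwards [lt_mem_nhds ht] with r hr using S.map_add' r s hr.le hs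

theorem IsAnalytic.continuousOn_deriv (h : S.IsAnalytic) :
    ContinuousOn (deriv S.toFun) (Ioi 0) := by
  intro t ht
  have ht2 : 0 < t / 2 := half_pos ht
  have h1 : ContinuousAt (fun r => (S (r - t / 2)).comp (deriv S.toFun (t / 2))) t := by
    have : ContinuousAt (fun r => S (r - t / 2)) t :=
      ContinuousAt.comp (f := fun r => r - t / 2) (g := S.toFun)
        (h.differentiableAt (by linarith)).continuousAt (by fun_prop)
    exact this.clm_comp continuousAt_const
  refine (h1.congr ?_).continuousWithinAt
  filter_upwards [lt_mem_nhds (half_lt_self ht)] with r hr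
  rw [← h.deriv_add_left (by linarith) ht2, sub_add_cancel]

/-- The derivative of an analytic exponentially stable semigroup is bounded by `C / t`. Near `0`
this is the Cauchy estimate on a disc of radius proportional to `t`; away from `0` the semigroup
law reduces it to exponential decay. -/
theorem IsAnalytic.exists_norm_deriv_le [CompleteSpace X] (h : S.IsAnalytic)
    (hS : S.IsExponentiallyStable) :
    ∃ C : ℝ, 0 < C ∧ ∀ t : ℝ, 0 < t → ‖deriv S.toFun t‖ ≤ C * t⁻¹ := by
  obtain ⟨M, ω, hM, hω, hSt⟩ := hS
  have ha := h
  obtain ⟨θ, hθ, hθ', F, hFS, hF, -, hF0⟩ := h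
  have hpi := Real.pi_pos
  obtain ⟨δ, C, hδ, hC, hFC⟩ :=
    exists_norm_le_of_tendsto (hF0 (θ / 2) (half_pos hθ) (half_lt_self hθ))
  obtain ⟨ε, hε, hball⟩ :=
    exists_closedBall_subset_openSector (half_pos hθ) (by linarith : θ / 2 ≤ Real.pi)
  have hopen : IsOpen (openSector θ) := isOpen_openSector (hθ'.trans (by linarith))
  have hsub : openSector (θ / 2) ⊆ openSector θ := openSector_mono (half_lt_self hθ).le
  have small : ∀ t : ℝ, 0 < t → t < δ / (1 + ε) → ‖deriv S.toFun t‖ ≤ C / (ε * t) := by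
    intro t ht htδ
    have hd : HasDerivAt F (deriv F t) (t : ℂ) :=
      (hF.differentiableAt (hopen.mem_nhds (ofReal_mem_openSector hθ ht))).hasDerivAt
    have hd' : HasDerivAt S.toFun (deriv F t) t := by
      refine (hasDerivAt_comp_ofReal hd).congr_of_eventuallyEq ?_
      filter_upwards [lt_mem_nhds ht] with r hr using (hFS r hr).symm
    rw [hd'.deriv]
    refine Complex.norm_deriv_le_of_forall_mem_sphere_norm_le (by positivity) ?_ fun z hz => ?_
    · refine (hF.mono ((hball t ht).trans hsub)).diffContOnCl_ball subset_rfl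
    · refine hFC z (hball t ht (Metric.sphere_subset_closedBall hz)) ?_
      have h1 : ‖z - t‖ = ε * t := by simpa using hz
      have h2 : ‖z‖ ≤ ‖z - t‖ + ‖(t : ℂ)‖ := by simpa using norm_add_le (z - t) (t : ℂ)
      rw [h1, Complex.norm_real, Real.norm_of_nonneg ht.le] at h2
      rw [lt_div_iff₀ (by positivity)] at htδ
      linarith
  set τ : ℝ := δ / (1 + ε) / 2 with hτ
  have hτ0 : 0 < τ := by positivity
  have hτδ : τ < δ / (1 + ε) := half_lt_self (by positivity)
  set E : ℝ := C / (ε * τ) with hE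
  have hE0 : 0 < E := by positivity
  refine ⟨C / ε + M * E * (ω⁻¹ + τ), by positivity, fun t ht => ?_⟩
  rw [← div_eq_mul_inv, le_div_iff₀ ht]
  rcases le_or_gt t τ with htτ | htτ
  · have := small t ht (htτ.trans_lt hτδ)
    calc ‖deriv S.toFun t‖ * t ≤ C / (ε * t) * t := by gcongr
      _ = C / ε := by field_simp
      _ ≤ _ := le_add_of_nonneg_right (by positivity)
  · have h1 : deriv S.toFun t = (S (t - τ)).comp (deriv S.toFun τ) := by
      rw [← ha.deriv_add_left (by linarith) hτ0, sub_add_cancel]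
    have h2 : ‖deriv S.toFun t‖ ≤ M * Real.exp (-ω * (t - τ)) * E := by
      rw [h1]
      refine (ContinuousLinearMap.opNorm_comp_le _ _).trans ?_
      exact mul_le_mul (hSt _ (by linarith)) (small τ hτ0 hτδ) (norm_nonneg _) (by positivity)
    have h3 : Real.exp (-ω * (t - τ)) * t ≤ ω⁻¹ + τ := by
      have e1 : Real.exp (-ω * (t - τ)) ≤ 1 := Real.exp_le_one_iff.2 (by nlinarith)
      have e2 : Real.exp (-ω * (t - τ)) * (ω * (t - τ)) ≤ 1 := by
        have := Real.add_one_le_exp (ω * (t - τ))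
        rw [neg_mul, Real.exp_neg, inv_mul_le_iff₀ (Real.exp_pos _)]
        linarith
      have e3 : Real.exp (-ω * (t - τ)) * (t - τ) ≤ ω⁻¹ := by
        rw [← one_div, le_div_iff₀ hω]
        linarith
      nlinarith
    calc ‖deriv S.toFun t‖ * t ≤ M * Real.exp (-ω * (t - τ)) * E * t := by gcongr
      _ = M * E * (Real.exp (-ω * (t - τ)) * t) := by ring
      _ ≤ M * E * (ω⁻¹ + τ) := by gcongr
      _ ≤ _ := le_add_of_nonneg_left (by positivity)

end C0Semigroup

/-! ### The smoothing estimate -/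

theorem integrableOn_rpow_mul_inv_one_add {β : ℝ} (h0 : 0 < β) (h1 : β < 1) :
    IntegrableOn (fun w : ℝ => w ^ (β - 1) * (1 + w)⁻¹) (Ioi 0) := by
  have hmeas : ∀ s : Set ℝ, AEStronglyMeasurable (fun w : ℝ => w ^ (β - 1) * (1 + w)⁻¹)
      (volume.restrict s) := fun s => by
    have : Measurable (fun w : ℝ => w ^ (β - 1) * (1 + w)⁻¹) := by fun_prop
    exact this.aestronglyMeasurable
  rw [← Ioc_union_Ioi_eq_Ioi (zero_le_one (α := ℝ))]
  refine IntegrableOn.union ?_ ?_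
  · have hi : IntegrableOn (fun w : ℝ => w ^ (β - 1)) (Ioc 0 1) :=
      (intervalIntegrable_iff_integrableOn_Ioc_of_le zero_le_one).1
        (intervalIntegral.intervalIntegrable_rpow' (by linarith))
    refine Integrable.mono' hi (hmeas _) ?_
    filter_upwards [ae_restrict_mem measurableSet_Ioc] with w hw
    have hw0 : 0 < w := hw.1
    rw [Real.norm_of_nonneg (by positivity)]
    exact mul_le_of_le_one_right (by positivity) (inv_le_one_of_one_le₀ (by linarith))
  · have hi : IntegrableOn (fun w : ℝ => w ^ (β - 2)) (Ioi 1) :=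
      (integrableOn_Ioi_rpow_iff zero_lt_one).2 (by linarith)
    refine Integrable.mono' hi (hmeas _) ?_
    filter_upwards [ae_restrict_mem measurableSet_Ioi] with w hw
    have hw0 : 0 < w := lt_trans one_pos hw
    rw [Real.norm_of_nonneg (by positivity), show β - 2 = (β - 1) + (-1) by ring,
      Real.rpow_add hw0, Real.rpow_neg_one]
    gcongr
    linarith

theorem integral_rpow_mul_inv_one_add_pos {β : ℝ} (h0 : 0 < β) (h1 : β < 1) :
    0 < ∫ w in Ioi (0 : ℝ), w ^ (β - 1) * (1 + w)⁻¹ := by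
  have hpos : ∀ w ∈ Ioi (0 : ℝ), 0 < w ^ (β - 1) * (1 + w)⁻¹ := fun w hw => by
    have hw0 : 0 < w := hw
    positivity
  rw [setIntegral_pos_iff_support_of_nonneg_ae _ (integrableOn_rpow_mul_inv_one_add h0 h1)]
  · have : Function.support (fun w : ℝ => w ^ (β - 1) * (1 + w)⁻¹) ∩ Ioi 0 = Ioi 0 :=
      inter_eq_right.2 fun w hw => (hpos w hw).ne'
    rw [this]
    simp
  · filter_upwards [ae_restrict_mem measurableSet_Ioi] with w hw using (hpos w hw).le

theorem integral_rpow_mul_inv_add {β t : ℝ} (ht : 0 < t) :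
    ∫ s in Ioi (0 : ℝ), s ^ (β - 1) * (t + s)⁻¹ =
      t ^ (β - 1) * ∫ w in Ioi (0 : ℝ), w ^ (β - 1) * (1 + w)⁻¹ := by
  have h := integral_comp_mul_left_Ioi' (fun s : ℝ => s ^ (β - 1) * (t + s)⁻¹) 0 ht
  rw [mul_zero] at h
  rw [← h, ← integral_const_mul, smul_eq_mul, ← integral_const_mul]
  refine setIntegral_congr_fun measurableSet_Ioi fun w hw => ?_
  have hw0 : 0 < w := hw
  rw [Real.mul_rpow ht.le hw0.le, show t + t * w = t * (1 + w) by ring, mul_inv]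
  field_simp

theorem integrableOn_rpow_mul_inv_add {β t : ℝ} (h0 : 0 < β) (h1 : β < 1) (ht : 0 < t) :
    IntegrableOn (fun s : ℝ => s ^ (β - 1) * (t + s)⁻¹) (Ioi 0) := by
  have h := integrableOn_Ioi_comp_mul_left_iff (fun s : ℝ => s ^ (β - 1) * (t + s)⁻¹) 0 ht
  rw [mul_zero] at h
  rw [← h]
  refine IntegrableOn.congr_fun
    ((integrableOn_rpow_mul_inv_one_add h0 h1).const_mul (t ^ (β - 1) * t⁻¹)) (fun w hw => ?_)
    measurableSet_Ioi
  have hw0 : 0 < w := hw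
  rw [Real.mul_rpow ht.le hw0.le, show t + t * w = t * (1 + w) by ring, mul_inv]
  ring

theorem rpow_mul_rpow_scaling {β s w : ℝ} (hs : 0 < s) (hw : 0 < w) :
    s ^ (-β) * (s * (s * w) ^ (β - 1)) = w ^ (β - 1) := by
  rw [Real.mul_rpow hs.le hw.le]
  have : s ^ (-β) * (s * s ^ (β - 1)) = 1 := by
    nth_rewrite 2 [← Real.rpow_one s]
    rw [← Real.rpow_add hs, ← Real.rpow_add hs, show -β + (1 + (β - 1)) = 0 by ring,
      Real.rpow_zero]
  calc s ^ (-β) * (s * (s ^ (β - 1) * w ^ (β - 1)))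
      = s ^ (-β) * (s * s ^ (β - 1)) * w ^ (β - 1) := by ring
    _ = _ := by rw [this, one_mul]

/-- The composition of two fractional integrals of complementary orders `1 - β` and `β` is a
multiple of the integral. The substitution `r = s w` separates the variables, so that the constant
appears as `∫ w ^ (β - 1) / (1 + w)` and need not be evaluated. -/
theorem integral_rpow_smul_integral_rpow_smul {E : Type*} [NormedAddCommGroup E] [NormedSpace ℝ E]
    [CompleteSpace E]
    {G : ℝ → E} {β : ℝ} (h0 : 0 < β) (h1 : β < 1) (hG : ContinuousOn G (Ioi 0))
    (hGi : IntegrableOn G (Ioi 0)) :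
    ∫ s in Ioi (0 : ℝ), s ^ (-β) • ∫ r in Ioi (0 : ℝ), r ^ (β - 1) • G (s + r) =
      (∫ w in Ioi (0 : ℝ), w ^ (β - 1) * (1 + w)⁻¹) • ∫ s in Ioi (0 : ℝ), G s := by
  have e1 : ∀ s ∈ Ioi (0 : ℝ), s ^ (-β) • ∫ r in Ioi (0 : ℝ), r ^ (β - 1) • G (s + r) =
      ∫ w in Ioi (0 : ℝ), w ^ (β - 1) • G (s * (1 + w)) := by
    intro s hs
    have hs0 : 0 < s := hs
    have h := integral_comp_mul_left_Ioi' (fun r : ℝ => r ^ (β - 1) • G (s + r)) 0 hs0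
    rw [mul_zero] at h
    rw [← h, ← integral_smul, ← integral_smul]
    refine setIntegral_congr_fun measurableSet_Ioi fun w hw => ?_
    rw [smul_smul, smul_smul, mul_assoc, rpow_mul_rpow_scaling hs0 hw,
      show s + s * w = s * (1 + w) by ring]
  have e2 : ∀ w ∈ Ioi (0 : ℝ), ∫ s in Ioi (0 : ℝ), w ^ (β - 1) • G (s * (1 + w)) =
      (w ^ (β - 1) * (1 + w)⁻¹) • ∫ s in Ioi (0 : ℝ), G s := by
    intro w hw
    have hw1 : 0 < 1 + w := by linarith [mem_Ioi.1 hw]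
    rw [integral_smul, integral_comp_mul_right_Ioi _ _ hw1, zero_mul, smul_smul]
  have hint : ∀ w ∈ Ioi (0 : ℝ), IntegrableOn (fun s => w ^ (β - 1) • G (s * (1 + w))) (Ioi 0) := by
    intro w hw
    have hw1 : 0 < 1 + w := by linarith [mem_Ioi.1 hw]
    refine Integrable.smul _ ?_
    have := (integrableOn_Ioi_comp_mul_right_iff G 0 hw1).2
    rw [zero_mul] at this
    exact this hGi
  have hprod : Integrable (Function.uncurry fun s w : ℝ => w ^ (β - 1) • G (s * (1 + w)))
      ((volume.restrict (Ioi 0)).prod (volume.restrict (Ioi 0))) := by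
    rw [integrable_prod_iff']
    · refine ⟨?_, ?_⟩
      · filter_upwards [ae_restrict_mem measurableSet_Ioi] with w hw using hint w hw
      · refine IntegrableOn.congr_fun ((integrableOn_rpow_mul_inv_one_add h0 h1).mul_const
          (∫ s in Ioi (0 : ℝ), ‖G s‖)) (fun w hw => ?_) measurableSet_Ioi
        have hw0 : 0 < w := hw
        simp only [Function.uncurry_apply_pair, norm_smul]
        rw [integral_const_mul, integral_comp_mul_right_Ioi (fun s => ‖G s‖) _ (by linarith),
          zero_mul, smul_eq_mul, Real.norm_of_nonneg (by positivity), mul_assoc]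
    · rw [Measure.prod_restrict]
      refine ContinuousOn.aestronglyMeasurable ?_ (measurableSet_Ioi.prod measurableSet_Ioi)
      refine ContinuousOn.smul ?_ ?_
      · exact ContinuousOn.rpow_const continuousOn_snd fun p hp => Or.inl (ne_of_gt hp.2)
      · refine hG.comp (by fun_prop) fun p hp => ?_
        have h1 : 0 < p.1 := hp.1
        have h2 : 0 < p.2 := hp.2
        exact mul_pos h1 (by linarith)
  rw [setIntegral_congr_fun measurableSet_Ioi e1, integral_integral_swap hprod,
    setIntegral_congr_fun measurableSet_Ioi e2, integral_smul_const]

namespace C0Semigroup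

variable {X : Type*} [NormedAddCommGroup X] [NormedSpace ℂ X] {S : C0Semigroup X}

theorem IsAnalytic.integrableOn_rpow_smul (h : S.IsAnalytic) (hS : S.IsExponentiallyStable)
    {β : ℝ} (hβ : 0 < β) : IntegrableOn (fun t : ℝ => t ^ (β - 1) • S t) (Ioi 0) := by
  obtain ⟨M, ω, hM, hω, hSt⟩ := hS
  have hi : IntegrableOn (fun t : ℝ => M * (t ^ (β - 1) * Real.exp (-ω * t ^ (1 : ℝ)))) (Ioi 0) :=
    (integrableOn_rpow_mul_exp_neg_mul_rpow (by linarith) one_pos hω).const_mul M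
  refine Integrable.mono' hi ?_ ?_
  · refine ContinuousOn.aestronglyMeasurable ?_ measurableSet_Ioi
    exact (ContinuousOn.rpow_const continuousOn_id fun p hp => Or.inl (ne_of_gt hp)).smul
      h.continuousOn
  · filter_upwards [ae_restrict_mem measurableSet_Ioi] with t ht
    have ht0 : 0 < t := ht
    rw [norm_smul, Real.norm_of_nonneg (by positivity), Real.rpow_one]
    calc t ^ (β - 1) * ‖S t‖ ≤ t ^ (β - 1) * (M * Real.exp (-ω * t)) := by
          gcongr
          exact hSt t ht0.le
      _ = _ := by ring

theorem IsAnalytic.Gamma_smul_negFracPow_apply [CompleteSpace X] (h : S.IsAnalytic)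
    (hS : S.IsExponentiallyStable) {β : ℝ} (hβ : 0 < β) (x : X) :
    Real.Gamma β • S.negFracPow β x = ∫ r in Ioi (0 : ℝ), r ^ (β - 1) • S r x := by
  rw [negFracPow, if_neg hβ.ne', _root_.smul_apply, smul_smul,
    mul_inv_cancel₀ (Real.Gamma_pos_of_pos hβ).ne', one_smul,
    ContinuousLinearMap.integral_apply (h.integrableOn_rpow_smul hS hβ)]
  rfl

theorem IsAnalytic.integral_deriv_apply [CompleteSpace X] (h : S.IsAnalytic)
    (hS : S.IsExponentiallyStable) {t : ℝ} (ht : 0 < t) (x : X) :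
    IntegrableOn (fun w : ℝ => deriv S.toFun (t + w) x) (Ioi 0) ∧
      ∫ w in Ioi (0 : ℝ), deriv S.toFun (t + w) x = -S t x := by
  obtain ⟨M, ω, hM, hω, hSt⟩ := hS
  have hexp : IntegrableOn (fun w : ℝ => M * Real.exp (-ω * w) * (‖deriv S.toFun t‖ * ‖x‖))
      (Ioi 0) :=
    ((exp_neg_integrableOn_Ioi 0 hω).const_mul M).mul_const _
  have hint : IntegrableOn (fun w : ℝ => deriv S.toFun (t + w) x) (Ioi 0) := by
    refine Integrable.mono' hexp ?_ ?_
    · refine ContinuousOn.aestronglyMeasurable ?_ measurableSet_Ioi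
      refine ContinuousOn.clm_apply (h.continuousOn_deriv.comp (by fun_prop) fun w hw => ?_)
        continuousOn_const
      exact add_pos ht hw
    · filter_upwards [ae_restrict_mem measurableSet_Ioi] with w hw
      have hw0 : 0 < w := hw
      rw [add_comm, h.deriv_add_left hw0.le ht, ContinuousLinearMap.comp_apply]
      refine (ContinuousLinearMap.le_opNorm _ _).trans ?_
      exact mul_le_mul (hSt w hw0.le) (ContinuousLinearMap.le_opNorm _ _) (norm_nonneg _)
        (by positivity)
  refine ⟨hint, ?_⟩
  have hderiv : ∀ w ∈ Ici (0 : ℝ), HasDerivAt (fun r => S (t + r) x) (deriv S.toFun (t + w) x) w :=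
    fun w hw => by
    have h1 : HasDerivAt (fun r => S (t + r)) (deriv S.toFun (t + w)) w :=
      (h.differentiableAt (by linarith [mem_Ici.1 hw])).hasDerivAt.comp_const_add t w
    exact ((ContinuousLinearMap.apply ℂ X x).restrictScalars ℝ).hasFDerivAt.comp_hasDerivAt w h1
  have hlim : Tendsto (fun r => S (t + r) x) atTop (𝓝 0) := by
    have h0 : Tendsto (fun r : ℝ => M * Real.exp (-ω * (t + r)) * ‖x‖) atTop (𝓝 (M * 0 * ‖x‖)) := by
      refine ((Real.tendsto_exp_atBot.comp ?_).const_mul M).mul_const _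
      exact (tendsto_atTop_add_const_left _ t tendsto_id).const_mul_atTop_of_neg (by linarith)
    rw [mul_zero, zero_mul] at h0
    refine squeeze_zero_norm' ?_ h0
    filter_upwards [eventually_ge_atTop 0] with r hr
    refine (ContinuousLinearMap.le_opNorm _ _).trans ?_
    gcongr
    exact hSt _ (by linarith)
  have := integral_Ioi_of_hasDerivAt_of_tendsto' hderiv hint hlim
  simpa using this

/-- The smoothing estimate `‖T(t) x‖ ≤ C t ^ (-α) ‖(-A) ^ (-α) x‖`. For `α > 0` put
`y = (-A) ^ (-α) x`; then `T(t) x` is a multiple of `∫ s ^ (-α) T'(t + s) y ds`, which is estimated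
with `‖T'(r)‖ ≤ C / r`. -/
theorem IsAnalytic.exists_norm_apply_le [CompleteSpace X] (h : S.IsAnalytic)
    (hS : S.IsExponentiallyStable) {α : ℝ} (hα₀ : 0 ≤ α) (hα₁ : α < 1) :
    ∃ C : ℝ, 0 < C ∧ ∀ t : ℝ, 0 < t → ∀ x : X,
      ‖S t x‖ ≤ C * t ^ (-α) * ‖S.negFracPow α x‖ := by
  rcases hα₀.eq_or_lt with rfl | hα
  · obtain ⟨M, ω, hM, hω, hSt⟩ := hS
    refine ⟨M, hM, fun t ht x => ?_⟩
    have h1 : S.negFracPow 0 x = x := by simp [negFracPow]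
    rw [h1, neg_zero, Real.rpow_zero, mul_one]
    refine (ContinuousLinearMap.le_opNorm _ _).trans ?_
    gcongr
    refine (hSt t ht.le).trans (mul_le_of_le_one_right hM.le (Real.exp_le_one_iff.2 ?_))
    nlinarith
  obtain ⟨C, hC, hD⟩ := h.exists_norm_deriv_le hS
  set c : ℝ := ∫ w in Ioi (0 : ℝ), w ^ (α - 1) * (1 + w)⁻¹ with hc
  set c' : ℝ := ∫ w in Ioi (0 : ℝ), w ^ ((1 - α) - 1) * (1 + w)⁻¹ with hc'
  have hc0 : 0 < c := integral_rpow_mul_inv_one_add_pos hα hα₁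
  have hc'0 : 0 < c' := integral_rpow_mul_inv_one_add_pos (by linarith) (by linarith)
  have hΓ : 0 < Real.Gamma α := Real.Gamma_pos_of_pos hα
  refine ⟨c⁻¹ * (Real.Gamma α * C * c'), by positivity, fun t ht x => ?_⟩
  obtain ⟨hGi, hGint⟩ := h.integral_deriv_apply hS ht x
  have hG : ContinuousOn (fun w : ℝ => deriv S.toFun (t + w) x) (Ioi 0) :=
    ContinuousOn.clm_apply (h.continuousOn_deriv.comp (by fun_prop) fun w hw => add_pos ht hw)
      continuousOn_const
  have hxi : IntegrableOn (fun r : ℝ => r ^ (α - 1) • S r x) (Ioi 0) :=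
    (h.integrableOn_rpow_smul hS hα).apply_continuousLinearMap x
  have key := integral_rpow_smul_integral_rpow_smul hα hα₁ hG hGi
  rw [hGint] at key
  have inner : ∀ s ∈ Ioi (0 : ℝ), s ^ (-α) • ∫ r in Ioi (0 : ℝ), r ^ (α - 1) •
      deriv S.toFun (t + (s + r)) x =
      s ^ (-α) • deriv S.toFun (t + s) (Real.Gamma α • S.negFracPow α x) := by
    intro s hs
    have hs0 : 0 < s := hs
    rw [h.Gamma_smul_negFracPow_apply hS hα, ← ContinuousLinearMap.integral_comp_comm _ hxi]
    congr 1
    refine setIntegral_congr_fun measurableSet_Ioi fun r hr => ?_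
    rw [← add_assoc, h.deriv_add_right (le_of_lt hr) (by linarith), ContinuousLinearMap.comp_apply]
    exact ((deriv S.toFun (t + s)).toLinearMap.map_smul_of_tower _ _).symm
  rw [setIntegral_congr_fun measurableSet_Ioi inner] at key
  have hbound : ‖∫ s in Ioi (0 : ℝ), s ^ (-α) •
      deriv S.toFun (t + s) (Real.Gamma α • S.negFracPow α x)‖ ≤
      ∫ s in Ioi (0 : ℝ), s ^ ((1 - α) - 1) * (t + s)⁻¹ *
        (C * (Real.Gamma α * ‖S.negFracPow α x‖)) := by
    refine norm_integral_le_of_norm_le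
      ((integrableOn_rpow_mul_inv_add (by linarith) (by linarith) ht).mul_const _) ?_
    filter_upwards [ae_restrict_mem measurableSet_Ioi] with s hs
    have hs0 : 0 < s := hs
    rw [norm_smul, Real.norm_of_nonneg (by positivity), show (1 - α) - 1 = -α by ring]
    calc s ^ (-α) * ‖deriv S.toFun (t + s) (Real.Gamma α • S.negFracPow α x)‖
        ≤ s ^ (-α) * ((C * (t + s)⁻¹) * (Real.Gamma α * ‖S.negFracPow α x‖)) := by
          gcongr
          refine (ContinuousLinearMap.le_opNorm _ _).trans ?_
          rw [norm_smul, Real.norm_of_nonneg hΓ.le]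
          gcongr
          exact hD _ (by linarith)
      _ = _ := by ring
  rw [key, integral_mul_const, integral_rpow_mul_inv_add ht, smul_neg, norm_neg, norm_smul,
    Real.norm_of_nonneg hc0.le, ← hc', show (1 - α) - 1 = -α by ring] at hbound
  calc ‖S t x‖ = c⁻¹ * (c * ‖S t x‖) := by field_simp
    _ ≤ c⁻¹ * (t ^ (-α) * c' * (C * (Real.Gamma α * ‖S.negFracPow α x‖))) := by gcongr
    _ = _ := by ring

end C0Semigroup

/-! ### The kernel of the input map -/

namespace C0Semigroup

variable {X : Type*} [NormedAddCommGroup X] [NormedSpace ℂ X] {S : C0Semigroup X}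
variable {U : Type*} [NormedAddCommGroup U] [NormedSpace ℝ U]

theorem norm_toExtrapolation_le (S : C0Semigroup X) (μ : ℂ) (x : X) :
    ‖S.toExtrapolation μ x‖ ≤ ‖S.resolvent μ‖ * ‖x‖ := by
  rw [CompletionAlong.norm_incl]
  exact (S.resolvent μ).le_opNorm x

/-- The embedding `X → X₋₁` as a bounded operator. -/
noncomputable def toExtrapolationL (S : C0Semigroup X) (μ : ℂ) : X →L[ℂ] S.Extrapolation μ :=
  (S.toExtrapolation μ).mkContinuous ‖S.resolvent μ‖ (S.norm_toExtrapolation_le μ)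

@[simp]
theorem toExtrapolationL_apply (S : C0Semigroup X) (μ : ℂ) (x : X) :
    S.toExtrapolationL μ x = S.toExtrapolation μ x := rfl

theorem toState_toExtrapolation {μ : ℂ} (hμ : μ ∈ S.resolventSet) (x : X) :
    S.toState μ (S.toExtrapolation μ x) = x :=
  Function.leftInverse_invFun (S.toExtrapolation_injective hμ) x

/-- The bounded extension of `T(t)` to an operator `X_{-α} → X`. It is meaningful for `t > 0`, by
the smoothing estimate. -/
noncomputable def smoothing [CompleteSpace X] (S : C0Semigroup X) (α t : ℝ) :
    S.FracExtrapolation α →L[ℂ] X :=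
  (S t).toLinearMap.extendOfNorm (CompletionAlong.incl (S.negFracPow α))

/-- The dominating function `t ↦ t ^ (-α) e ^ (-ω t)` of the kernel of the input map. -/
noncomputable def kernelBound (α ω t : ℝ) : ℝ := t ^ (-α) * Real.exp (-ω * t)

/-- `K(t) : U → X` is the operator `T₋₁(t) B` for `t > 0`, with values in `X`; it is continuous in
operator norm and dominated by `C t ^ (-α) e ^ (-ω t)`. -/
structure IsInputKernel (S : C0Semigroup X) (μ : ℂ) (B : U →L[ℝ] S.Extrapolation μ) (α ω C : ℝ)
    (K : ℝ → U →L[ℝ] X) : Prop where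
  continuousOn : ContinuousOn K (Ioi 0)
  norm_le : ∀ t : ℝ, 0 < t → ‖K t‖ ≤ C * kernelBound α ω t
  toExtrapolation_apply : ∀ t : ℝ, 0 < t → ∀ v : U,
    S.toExtrapolation μ (K t v) = S.extrapolated μ t (B v)
  add_apply : ∀ s t : ℝ, 0 ≤ s → 0 < t → ∀ v : U, K (s + t) v = S s (K t v)

theorem IsAnalytic.exists_norm_apply_le_kernelBound [CompleteSpace X] (h : S.IsAnalytic)
    (hS : S.IsExponentiallyStable) {α : ℝ} (hα₀ : 0 ≤ α) (hα₁ : α < 1) :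
    ∃ C ω : ℝ, 0 < C ∧ 0 < ω ∧ ∀ t : ℝ, 0 < t → ∀ x : X,
      ‖S t x‖ ≤ C * kernelBound α ω t * ‖S.negFracPow α x‖ := by
  obtain ⟨C, hC, hCS⟩ := h.exists_norm_apply_le hS hα₀ hα₁
  obtain ⟨M, ω, hM, hω, hSt⟩ := hS
  refine ⟨M * C * 2 ^ α, ω / 2, by positivity, by positivity, fun t ht x => ?_⟩
  have ht2 : 0 < t / 2 := by positivity
  have e : S t x = S (t / 2) (S (t / 2) x) := by
    rw [← S.apply_add ht2.le ht2.le, add_halves]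
  rw [e]
  calc ‖S (t / 2) (S (t / 2) x)‖ ≤ ‖S (t / 2)‖ * ‖S (t / 2) x‖ := ContinuousLinearMap.le_opNorm _ _
    _ ≤ (M * Real.exp (-ω * (t / 2))) * (C * (t / 2) ^ (-α) * ‖S.negFracPow α x‖) :=
      mul_le_mul (hSt _ ht2.le) (hCS _ ht2 x) (norm_nonneg _) (by positivity)
    _ = _ := by
      rw [kernelBound, Real.div_rpow ht.le zero_le_two, Real.rpow_neg zero_le_two,
        show -ω * (t / 2) = -(ω / 2) * t by ring]
      field_simp

/-- The kernel `T₋₁(t) B` of the input map takes values in `X`. -/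
theorem IsAnalytic.exists_isInputKernel [CompleteSpace X] (h : S.IsAnalytic)
    (hS : S.IsExponentiallyStable) {μ : ℂ} (hμ : μ ∈ S.resolventSet)
    {B : U →L[ℝ] S.Extrapolation μ} {α : ℝ} (hα₀ : 0 ≤ α) (hα₁ : α < 1)
    (hB : S.MapsBoundedlyInto μ α B) :
    ∃ (ω C : ℝ) (K : ℝ → U →L[ℝ] X), 0 < ω ∧ 0 < C ∧ S.IsInputKernel μ B α ω C K := by
  obtain ⟨C, ω, hC, hω, hCS⟩ := h.exists_norm_apply_le_kernelBound hS hα₀ hα₁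
  obtain ⟨Bα, hBα⟩ := hB
  have hdense := CompletionAlong.denseRange_incl (S.negFracPow α)
  have hbd : ∀ t : ℝ, 0 < t → ∀ x : X, ‖(S t).toLinearMap x‖ ≤
      C * kernelBound α ω t * ‖CompletionAlong.incl (S.negFracPow α) x‖ := fun t ht x => by
    rw [CompletionAlong.norm_incl]
    exact hCS t ht x
  have hincl : ∀ t : ℝ, 0 < t → ∀ x : X,
      S.smoothing α t (CompletionAlong.incl (S.negFracPow α) x) = S t x := fun t ht x =>
    LinearMap.extendOfNorm_eq hdense ⟨_, hbd t ht⟩ x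
  have hnorm : ∀ t : ℝ, 0 < t → ‖S.smoothing α t‖ ≤ C * kernelBound α ω t := fun t ht =>
    LinearMap.opNorm_extendOfNorm_le hdense
      (by rw [kernelBound]; positivity) (hbd t ht)
  have hadd : ∀ s t : ℝ, 0 ≤ s → 0 < t →
      S.smoothing α (s + t) = (S s).comp (S.smoothing α t) := fun s t hs ht => by
    apply ContinuousLinearMap.coeFn_injective
    refine hdense.equalizer (ContinuousLinearMap.continuous _) (ContinuousLinearMap.continuous _) ?_
    funext x
    simp only [Function.comp_apply, ContinuousLinearMap.comp_apply]
    rw [hincl _ (by linarith), hincl _ ht, S.apply_add hs ht.le]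
  have hcont : ContinuousOn (S.smoothing α) (Ioi 0) := by
    intro t ht
    have ht2 : 0 < t / 2 := half_pos ht
    have h1 : ContinuousAt (fun r => (S (r - t / 2)).comp (S.smoothing α (t / 2))) t := by
      have : ContinuousAt (fun r => S (r - t / 2)) t :=
        ContinuousAt.comp (f := fun r => r - t / 2) (g := S.toFun)
          (h.differentiableAt (by linarith)).continuousAt (by fun_prop)
      exact this.clm_comp continuousAt_const
    refine (h1.congr ?_).continuousWithinAt
    filter_upwards [lt_mem_nhds (half_lt_self ht)] with r hr
    rw [← hadd _ _ (by linarith) ht2, sub_add_cancel]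
  refine ⟨ω, C * (‖Bα‖ + 1), fun t => ((S.smoothing α t).restrictScalars ℝ).comp Bα, hω,
    by positivity, ?_, ?_, ?_, ?_⟩
  · have h1 : ContinuousOn (fun t => (S.smoothing α t).restrictScalars ℝ) (Ioi 0) :=
      (ContinuousLinearMap.restrictScalarsIsometry ℂ _ _ ℝ ℝ).continuous.comp_continuousOn hcont
    exact h1.clm_comp continuousOn_const
  · intro t ht
    refine (ContinuousLinearMap.opNorm_comp_le _ _).trans ?_
    rw [ContinuousLinearMap.norm_restrictScalars]
    have hk : 0 ≤ kernelBound α ω t := by rw [kernelBound]; positivity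
    calc ‖S.smoothing α t‖ * ‖Bα‖ ≤ C * kernelBound α ω t * (‖Bα‖ + 1) := by
          gcongr
          · exact hnorm t ht
          · linarith
      _ = _ := by ring
  · intro t ht v
    have hcl : IsClosed {p : S.FracExtrapolation α × S.Extrapolation μ |
        S.toExtrapolationL μ (S.smoothing α t p.1) = S.extrapolated μ t p.2} :=
      isClosed_eq (by fun_prop) (by fun_prop)
    refine hcl.closure_subset_iff.2 ?_ (hBα v)
    rintro _ ⟨x, rfl⟩
    simp only [mem_ofPred_eq, toExtrapolationL_apply]
    rw [hincl t ht, S.extrapolated_toExtrapolation hμ ht.le]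
  · intro s t hs ht v
    simp only [ContinuousLinearMap.comp_apply, ContinuousLinearMap.coe_restrictScalars']
    rw [hadd s t hs ht, ContinuousLinearMap.comp_apply]

theorem kernelBound_nonneg {α ω t : ℝ} (ht : 0 ≤ t) : 0 ≤ kernelBound α ω t := by
  rw [kernelBound]; positivity

theorem kernelBound_anti {α ω s t : ℝ} (hα : 0 ≤ α) (hω : 0 ≤ ω) (hs : 0 < s) (hst : s ≤ t) :
    kernelBound α ω t ≤ kernelBound α ω s := by
  rw [kernelBound, kernelBound]
  refine mul_le_mul (Real.rpow_le_rpow_of_nonpos hs hst (by linarith))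
    (Real.exp_le_exp.2 (by nlinarith)) (Real.exp_pos _).le (by positivity)

theorem integrableOn_kernelBound_pow {α ω : ℝ} (hω : 0 < ω) {j : ℕ} (hj : 0 < j)
    (hjα : (j : ℝ) * α < 1) : IntegrableOn (fun t => kernelBound α ω t ^ j) (Ioi 0) := by
  have hj' : (0 : ℝ) < j := by exact_mod_cast hj
  have hi := integrableOn_rpow_mul_exp_neg_mul_rpow (s := -(j * α)) (b := j * ω) (by linarith)
    one_pos (by positivity)
  refine hi.congr_fun (fun t ht => ?_) measurableSet_Ioi
  have ht0 : 0 < t := ht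
  simp only [kernelBound]
  rw [mul_pow, ← Real.rpow_natCast, ← Real.rpow_mul ht0.le, ← Real.exp_nat_mul, Real.rpow_one]
  ring_nf

theorem integrableOn_kernelBound {α ω : ℝ} (hω : 0 < ω) (hα : α < 1) :
    IntegrableOn (kernelBound α ω) (Ioi 0) := by
  simpa using integrableOn_kernelBound_pow (α := α) hω one_pos (by simpa using hα)

theorem intervalIntegrable_kernelBound_sub {α ω τ : ℝ} (hω : 0 < ω) (hα : α < 1) (hτ : 0 ≤ τ) :
    IntervalIntegrable (fun s => kernelBound α ω (τ - s)) volume 0 τ := by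
  have h1 : IntervalIntegrable (kernelBound α ω) volume 0 τ :=
    (intervalIntegrable_iff_integrableOn_Ioc_of_le hτ).2
      ((integrableOn_kernelBound hω hα).mono_set Ioc_subset_Ioi_self)
  simpa using (h1.comp_sub_left τ).symm

namespace IsInputKernel

variable {μ : ℂ} {B : U →L[ℝ] S.Extrapolation μ} {α ω C : ℝ} {K : ℝ → U →L[ℝ] X}

theorem inputMap_eq [CompleteSpace X] (hK : S.IsInputKernel μ B α ω C K) {u : ℝ → U} {τ : ℝ}
    (hτ : 0 ≤ τ) (hu : IntervalIntegrable (fun s => K (τ - s) (u s)) volume 0 τ) :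
    S.inputMap μ B u τ = S.toExtrapolation μ (∫ s in (0 : ℝ)..τ, K (τ - s) (u s)) := by
  rw [inputMap, ← toExtrapolationL_apply, ← (S.toExtrapolationL μ).intervalIntegral_comp_comm hu]
  rw [intervalIntegral.integral_of_le hτ, intervalIntegral.integral_of_le hτ,
    integral_Ioc_eq_integral_Ioo, integral_Ioc_eq_integral_Ioo]
  refine setIntegral_congr_fun measurableSet_Ioo fun s hs => ?_
  exact (hK.toExtrapolation_apply (τ - s) (sub_pos.2 hs.2) (u s)).symm

theorem intervalIntegrable_of_continuousOn (hK : S.IsInputKernel μ B α ω C K) (hω : 0 < ω)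
    (hα : α < 1) {u : ℝ → U} {τ : ℝ} (hτ : 0 ≤ τ) (hu : ContinuousOn u (Icc 0 τ)) :
    IntervalIntegrable (fun s => K (τ - s) (u s)) volume 0 τ := by
  obtain ⟨R, hR⟩ := isCompact_Icc.exists_bound_of_continuousOn hu
  have hb := ((intervalIntegrable_kernelBound_sub hω hα hτ).const_mul C).mul_const R
  rw [intervalIntegrable_iff_integrableOn_Ioo_of_le hτ] at hb ⊢
  refine Integrable.mono' hb ?_ ?_
  · refine ContinuousOn.aestronglyMeasurable ?_ measurableSet_Ioo
    refine ContinuousOn.clm_apply (hK.continuousOn.comp (by fun_prop) fun s hs => sub_pos.2 hs.2)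
      (hu.mono Ioo_subset_Icc_self)
  · filter_upwards [ae_restrict_mem measurableSet_Ioo] with s hs
    refine (ContinuousLinearMap.le_opNorm _ _).trans ?_
    exact mul_le_mul (hK.norm_le _ (sub_pos.2 hs.2)) (hR s (Ioo_subset_Icc_self hs))
      (norm_nonneg _) ((norm_nonneg _).trans (hK.norm_le _ (sub_pos.2 hs.2)))

theorem isCAdmissible [CompleteSpace X] (hK : S.IsInputKernel μ B α ω C K) (hω : 0 < ω)
    (hα : α < 1) : S.IsCAdmissible μ B := fun τ hτ u hu => by
  rw [hK.inputMap_eq hτ.le (hK.intervalIntegrable_of_continuousOn hω hα hτ.le hu)]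
  exact ⟨_, rfl⟩

theorem mildSolution_eq [CompleteSpace X] (hK : S.IsInputKernel μ B α ω C K) {u : ℝ → U} {τ : ℝ}
    (hτ : 0 ≤ τ) (hu : IntervalIntegrable (fun s => K (τ - s) (u s)) volume 0 τ) (x : X) :
    S.mildSolution μ B x u τ =
      S.toExtrapolation μ (S τ x + ∫ s in (0 : ℝ)..τ, K (τ - s) (u s)) := by
  rw [mildSolution, hK.inputMap_eq hτ hu, _root_.map_add]

end IsInputKernel

end C0Semigroup

/-! ### Young's convolution inequality and input-to-state stability -/

/-- Young's inequality `‖a * b‖_p ≤ ‖a‖_p ‖b‖_1` for nonnegative functions on the line. -/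
theorem lintegral_convolution_rpow_le {a b : ℝ → ℝ≥0∞} (ha : AEMeasurable a) (hb : Measurable b)
    {p : ℝ} (hp : 1 ≤ p) :
    ∫⁻ x, (∫⁻ r, a r * b (x - r)) ^ p ≤ (∫⁻ r, a r ^ p) * (∫⁻ r, b r) ^ p := by
  have hbx : ∀ x : ℝ, ∫⁻ r, b (x - r) = ∫⁻ r, b r := fun x => lintegral_sub_left_eq_self b x
  have hap : AEMeasurable (fun r => a r ^ p) := ha.pow_const p
  -- Hölder's inequality, applied to the splitting `b = b ^ (1 / p) * b ^ (1 - 1 / p)`.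
  have h1 : ∀ x : ℝ, (∫⁻ r, a r * b (x - r)) ^ p ≤
      (∫⁻ r, a r ^ p * b (x - r)) * (∫⁻ r, b r) ^ (p - 1) := by
    intro x
    rcases hp.eq_or_lt with rfl | hp1
    · simp
    have hp0 : 0 < p := by linarith
    have hpq : p.HolderConjugate (Real.conjExponent p) := Real.HolderConjugate.conjExponent hp1
    set p' := Real.conjExponent p with hp'
    have hbm : Measurable fun r => b (x - r) := by fun_prop
    have hsum : 1 / p + 1 / p' = 1 := by simpa using hpq.inv_add_inv_eq_one
    have hp'0 : 0 < p' := hpq.symm.pos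
    have h := ENNReal.lintegral_mul_le_Lp_mul_Lq volume hpq
      (f := fun r => a r * b (x - r) ^ (1 / p)) (g := fun r => b (x - r) ^ (1 / p'))
      (ha.mul (hbm.pow_const _).aemeasurable) (hbm.pow_const _).aemeasurable
    have e1 : ∀ r, ((fun r => a r * b (x - r) ^ (1 / p)) * fun r => b (x - r) ^ (1 / p')) r =
        a r * b (x - r) := fun r => by
      simp only [Pi.mul_apply]
      rw [mul_assoc, ← ENNReal.rpow_add_of_nonneg _ _ (by positivity) (by positivity), hsum,
        ENNReal.rpow_one]
    have e2 : ∀ r, (a r * b (x - r) ^ (1 / p)) ^ p = a r ^ p * b (x - r) := fun r => by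
      rw [ENNReal.mul_rpow_of_nonneg _ _ hp0.le, ← ENNReal.rpow_mul, one_div_mul_cancel hp0.ne',
        ENNReal.rpow_one]
    have e3 : ∀ r, (b (x - r) ^ (1 / p')) ^ p' = b (x - r) := fun r => by
      rw [← ENNReal.rpow_mul, one_div_mul_cancel hp'0.ne', ENNReal.rpow_one]
    rw [lintegral_congr e1, lintegral_congr e2, lintegral_congr e3, hbx] at h
    have hpp : 1 / p' * p = p - 1 := by
      have : 1 / p' = 1 - 1 / p := by linarith
      rw [this, sub_mul, one_div_mul_cancel hp0.ne', one_mul]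
    calc (∫⁻ r, a r * b (x - r)) ^ p
        ≤ ((∫⁻ r, a r ^ p * b (x - r)) ^ (1 / p) * (∫⁻ r, b r) ^ (1 / p')) ^ p :=
          ENNReal.rpow_le_rpow h hp0.le
      _ = _ := by
        rw [ENNReal.mul_rpow_of_nonneg _ _ hp0.le, ← ENNReal.rpow_mul, ← ENNReal.rpow_mul, hpp,
          one_div_mul_cancel hp0.ne', ENNReal.rpow_one]
  have hprod : AEMeasurable (Function.uncurry fun x r : ℝ => a r ^ p * b (x - r))
      (volume.prod volume) := by
    refine AEMeasurable.mul hap.comp_snd (Measurable.aemeasurable ?_)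
    exact hb.comp (measurable_fst.sub measurable_snd)
  have hprod1 : AEMeasurable (fun x : ℝ => ∫⁻ r, a r ^ p * b (x - r)) := hprod.lintegral_prod_right'
  calc ∫⁻ x, (∫⁻ r, a r * b (x - r)) ^ p
      ≤ ∫⁻ x, (∫⁻ r, a r ^ p * b (x - r)) * (∫⁻ r, b r) ^ (p - 1) := lintegral_mono h1
    _ = (∫⁻ r, a r ^ p) * (∫⁻ r, b r) * (∫⁻ r, b r) ^ (p - 1) := by
      rw [lintegral_mul_const'' _ hprod1, lintegral_lintegral_swap hprod]
      congr 1
      have : ∀ r, ∫⁻ x, a r ^ p * b (x - r) = a r ^ p * ∫⁻ x, b x := fun r => by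
        rw [lintegral_const_mul _ (by fun_prop), lintegral_sub_right_eq_self b r]
      rw [lintegral_congr this, lintegral_mul_const'' _ hap]
    _ = _ := by
      rw [mul_assoc]
      congr 1
      conv_lhs => enter [1]; rw [← ENNReal.rpow_one (∫⁻ r, b r)]
      rw [← ENNReal.rpow_add_of_nonneg _ _ zero_le_one (by linarith)]
      congr 1
      ring

theorem integrable_indicator_of_integrableOn {E : Type*} [NormedAddCommGroup E] {f : ℝ → E}
    {s : Set ℝ} (hs : MeasurableSet s) (hf : IntegrableOn f s) : Integrable (s.indicator f) :=
  hf.integrable_indicator hs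

theorem isClassKInfty_const_mul {c : ℝ≥0} (hc : 0 < c) : IsClassKInfty (fun r => c * r) := by
  have hm : StrictMono (fun r : ℝ≥0 => c * r) := fun a b hab => mul_lt_mul_of_pos_left hab hc
  refine ⟨by fun_prop, mul_zero c, hm, ?_⟩
  rintro ⟨R, hR⟩
  have := hR ⟨c⁻¹ * (R + 1), rfl⟩
  simp only at this
  rw [mul_inv_cancel_left₀ hc.ne'] at this
  exact absurd this (not_le.2 (lt_add_one R))

namespace C0Semigroup

variable {X : Type*} [NormedAddCommGroup X] [NormedSpace ℂ X] {S : C0Semigroup X}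
variable {U : Type*} [NormedAddCommGroup U] [NormedSpace ℝ U]

namespace IsInputKernel

variable {μ : ℂ} {B : U →L[ℝ] S.Extrapolation μ} {α ω C : ℝ} {K : ℝ → U →L[ℝ] X}

/-- For an input `u ∈ L^q([0, t], U)` the convolution `∫ K(s - r) u(r) dr` converges for almost all
`s ∈ [0, t]`, and it is an `L^q` function whose norm is at most `‖K‖_1 ‖u‖_q`. Existence almost
everywhere and measurability come from the case `q = 1`, the norm bound from Young's inequality. -/
theorem convolution_estimate [CompleteSpace X] (hK : S.IsInputKernel μ B α ω C K) (hω : 0 < ω)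
    (hα : α < 1) (hC : 0 ≤ C) {q : ℝ≥0∞} (hq : 1 ≤ q) (hq' : q ≠ ∞) {t : ℝ} {u : ℝ → U}
    (hu : MemLp u q (volume.restrict (Icc 0 t))) :
    (∀ᵐ s ∂(volume.restrict (Icc 0 t)),
        IntervalIntegrable (fun r => K (s - r) (u r)) volume 0 s) ∧
      AEStronglyMeasurable (fun s => ∫ r in (0 : ℝ)..s, K (s - r) (u r))
        (volume.restrict (Icc 0 t)) ∧
      eLpNorm (fun s => ∫ r in (0 : ℝ)..s, K (s - r) (u r)) q (volume.restrict (Icc 0 t)) ≤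
        ENNReal.ofReal (C * ∫ s in Ioi (0 : ℝ), kernelBound α ω s) *
          eLpNorm u q (volume.restrict (Icc 0 t)) := by
  set kt : ℝ → U →L[ℝ] X := (Ioi (0 : ℝ)).indicator K with hkt
  set ut : ℝ → U := (Icc 0 t).indicator u with hut
  set L : U →L[ℝ] (U →L[ℝ] X) →L[ℝ] X := ContinuousLinearMap.apply ℝ X with hL
  have hki : Integrable kt := by
    have h : IntegrableOn K (Ioi 0) := by
      refine Integrable.mono' ((integrableOn_kernelBound hω hα).const_mul C)
        (hK.continuousOn.aestronglyMeasurable measurableSet_Ioi) ?_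
      filter_upwards [ae_restrict_mem measurableSet_Ioi] with s hs using hK.norm_le s hs
    exact integrable_indicator_of_integrableOn measurableSet_Ioi h
  have hui : Integrable ut := by
    rw [hut, integrable_indicator_iff measurableSet_Icc]
    exact hu.integrable hq
  -- The integrand of the convolution of the extended functions.
  have hind : ∀ s ∈ Icc 0 t, (fun r => L (ut r) (kt (s - r))) =
      (Ico 0 s).indicator fun r => K (s - r) (u r) := by
    intro s hs
    funext r
    by_cases hr : r ∈ Ico 0 s
    · have h1 : r ∈ Icc 0 t := ⟨hr.1, hr.2.le.trans hs.2⟩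
      have h2 : s - r ∈ Ioi (0 : ℝ) := sub_pos.2 hr.2
      simp [hut, hkt, hL, indicator_of_mem hr, indicator_of_mem h1, indicator_of_mem h2]
    · rw [indicator_of_notMem hr]
      by_cases h1 : r ∈ Icc 0 t
      · have h2 : s - r ∉ Ioi (0 : ℝ) := fun h2 => hr ⟨h1.1, sub_pos.1 h2⟩
        simp [hkt, indicator_of_notMem h2]
      · simp [hut, indicator_of_notMem h1]
  have hconv : ∀ s ∈ Icc 0 t, convolution ut kt L volume s =
      ∫ r in (0 : ℝ)..s, K (s - r) (u r) := by
    intro s hs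
    rw [convolution_def, hind s hs, integral_indicator measurableSet_Ico,
      intervalIntegral.integral_of_le hs.1, integral_Ioc_eq_integral_Ioo,
      integral_Ico_eq_integral_Ioo]
  have hconv' : (fun s => ∫ r in (0 : ℝ)..s, K (s - r) (u r)) =ᵐ[volume.restrict (Icc 0 t)]
      convolution ut kt L volume := by
    filter_upwards [ae_restrict_mem measurableSet_Icc] with s hs using (hconv s hs).symm
  refine ⟨?_, ?_, ?_⟩
  · filter_upwards [ae_restrict_mem measurableSet_Icc,
      ae_restrict_of_ae (hui.ae_convolution_exists L hki)] with s hs hex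
    rw [intervalIntegrable_iff_integrableOn_Ico_of_le hs.1]
    have := hex.integrable
    rwa [hind s hs, integrable_indicator_iff measurableSet_Ico] at this
  · exact (hui.integrable_convolution L hki).aestronglyMeasurable.restrict.congr hconv'.symm
  have hq0 : q ≠ 0 := (zero_lt_one.trans_le hq).ne'
  have hp : 1 ≤ q.toReal := by
    rw [← ENNReal.toReal_one]
    exact ENNReal.toReal_mono hq' hq
  set b : ℝ → ℝ≥0∞ := (Ioi (0 : ℝ)).indicator fun s => ENNReal.ofReal (C * kernelBound α ω s)
    with hb
  have hbm : Measurable b := by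
    refine Measurable.indicator ?_ measurableSet_Ioi
    unfold kernelBound
    fun_prop
  have hbint : ∫⁻ s, b s = ENNReal.ofReal (C * ∫ s in Ioi (0 : ℝ), kernelBound α ω s) := by
    rw [hb, lintegral_indicator measurableSet_Ioi, ← integral_const_mul,
      ofReal_integral_eq_lintegral_ofReal ((integrableOn_kernelBound hω hα).const_mul C)]
    filter_upwards [ae_restrict_mem measurableSet_Ioi] with s hs
    exact mul_nonneg hC (kernelBound_nonneg (le_of_lt hs))
  have hkb : ∀ s, ‖kt s‖ₑ ≤ b s := by
    intro s
    by_cases hs : s ∈ Ioi (0 : ℝ)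
    · rw [hkt, hb, indicator_of_mem hs, indicator_of_mem hs, ← ofReal_norm]
      exact ENNReal.ofReal_le_ofReal (hK.norm_le s hs)
    · have h0 : kt s = 0 := indicator_of_notMem hs K
      rw [h0, ← ofReal_norm, norm_zero, ENNReal.ofReal_zero]
      exact zero_le
  have hpt : ∀ s, ‖convolution ut kt L volume s‖ₑ ≤ ∫⁻ r, ‖ut r‖ₑ * b (s - r) := by
    intro s
    rw [convolution_def]
    refine (enorm_integral_le_lintegral_enorm _).trans (lintegral_mono fun r => ?_)
    calc ‖L (ut r) (kt (s - r))‖ₑ = ‖kt (s - r) (ut r)‖ₑ := rfl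
      _ ≤ ‖kt (s - r)‖ₑ * ‖ut r‖ₑ := ContinuousLinearMap.le_opENorm _ _
      _ ≤ _ := by
        rw [mul_comm]
        exact mul_le_mul_right (hkb _) _
  rw [eLpNorm_congr_ae hconv']
  calc eLpNorm (convolution ut kt L volume) q (volume.restrict (Icc 0 t))
      ≤ eLpNorm (convolution ut kt L volume) q volume := eLpNorm_restrict_le _ _ _ _
    _ ≤ eLpNorm ut q volume * ∫⁻ s, b s := by
      rw [eLpNorm_eq_lintegral_rpow_enorm_toReal hq0 hq',
        eLpNorm_eq_lintegral_rpow_enorm_toReal hq0 hq', one_div,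
        ENNReal.rpow_inv_le_iff (by linarith), ENNReal.mul_rpow_of_nonneg _ _ (by linarith),
        ← ENNReal.rpow_mul, inv_mul_cancel₀ (by linarith), ENNReal.rpow_one]
      refine (lintegral_mono fun s => ?_).trans
        (lintegral_convolution_rpow_le hui.aestronglyMeasurable.enorm hbm hp)
      exact ENNReal.rpow_le_rpow (hpt s) (by linarith)
    _ = _ := by
      rw [hbint, hut, eLpNorm_indicator_eq_eLpNorm_restrict measurableSet_Icc, mul_comm]

end IsInputKernel

theorem memLp_apply_of_norm_le {M ω : ℝ} (hω : 0 < ω)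
    (hSt : ∀ t : ℝ, 0 ≤ t → ‖S t‖ ≤ M * Real.exp (-ω * t)) {q : ℝ≥0∞} (hq : 1 ≤ q) (hq' : q ≠ ∞)
    {t : ℝ} (x : X) :
    MemLp (fun s => S s x) q (volume.restrict (Icc 0 t)) ∧
      eLpNorm (fun s => S s x) q (volume.restrict (Icc 0 t)) ≤
        eLpNorm (fun s => M * Real.exp (-ω * s)) q (volume.restrict (Ici 0)) * ‖x‖ₑ ∧
      eLpNorm (fun s => M * Real.exp (-ω * s)) q (volume.restrict (Ici 0)) ≠ ∞ := by
  have hp : 1 ≤ q.toReal := by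
    rw [← ENNReal.toReal_one]
    exact ENNReal.toReal_mono hq' hq
  have hfin : MemLp (fun s => M * Real.exp (-ω * s)) q (volume.restrict (Ici 0)) := by
    refine MemLp.const_mul ?_ M
    rw [← integrable_norm_rpow_iff (Continuous.aestronglyMeasurable (by fun_prop))
      (zero_lt_one.trans_le hq).ne' hq']
    have h1 : IntegrableOn (fun s : ℝ => Real.exp (-(ω * q.toReal) * s)) (Ici 0) := by
      rw [integrableOn_Ici_iff_integrableOn_Ioi]
      exact exp_neg_integrableOn_Ioi 0 (by positivity)
    refine h1.congr (.of_forall fun s => ?_)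
    simp only
    rw [Real.norm_of_nonneg (Real.exp_pos _).le, ← Real.exp_mul]
    ring_nf
  have hle : eLpNorm (fun s => S s x) q (volume.restrict (Icc 0 t)) ≤
      eLpNorm (fun s => M * Real.exp (-ω * s)) q (volume.restrict (Ici 0)) * ‖x‖ₑ := by
    have h1 : eLpNorm (fun s => S s x) q (volume.restrict (Icc 0 t)) ≤
        eLpNorm (‖x‖ • fun s => M * Real.exp (-ω * s)) q (volume.restrict (Icc 0 t)) := by
      refine eLpNorm_mono_ae_real ?_
      filter_upwards [ae_restrict_mem measurableSet_Icc] with s hs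
      rw [Pi.smul_apply, smul_eq_mul, mul_comm]
      exact ContinuousLinearMap.le_of_opNorm_le _ (hSt s hs.1) x
    refine h1.trans ?_
    rw [eLpNorm_const_smul ‖x‖, enorm_norm, mul_comm]
    gcongr
    exact Icc_subset_Ici_self
  refine ⟨⟨?_, hle.trans_lt (ENNReal.mul_lt_top hfin.2 enorm_lt_top)⟩, hle, hfin.2.ne⟩
  exact ((S.continuousOn' x).mono Icc_subset_Ici_self).aestronglyMeasurable measurableSet_Icc

/-- Input-to-state stability from `L^q` to `L^q`, with linear comparison functions. -/
theorem IsInputKernel.isLpLqISS [CompleteSpace X] {μ : ℂ} (hμ : μ ∈ S.resolventSet)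
    {B : U →L[ℝ] S.Extrapolation μ} {α ω C : ℝ} {K : ℝ → U →L[ℝ] X}
    (hK : S.IsInputKernel μ B α ω C K) (hω : 0 < ω) (hα : α < 1) (hC : 0 ≤ C)
    (hS : S.IsExponentiallyStable) {q : ℝ≥0∞} (hq : 1 ≤ q) (hq' : q ≠ ∞) :
    S.IsLpLqISS μ B q q := by
  obtain ⟨M, ω₁, hM, hω₁, hSt⟩ := hS
  set c₁ : ℝ≥0 :=
    (eLpNorm (fun s => M * Real.exp (-ω₁ * s)) q (volume.restrict (Ici 0))).toNNReal with hc₁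
  set c₂ : ℝ≥0 := (C * ∫ s in Ioi (0 : ℝ), kernelBound α ω s).toNNReal with hc₂
  have hstate : ∀ (t : ℝ) (x : X) (u : ℝ → U), MemLp u q (volume.restrict (Icc 0 t)) →
      S.InLqState μ q t (S.mildSolution μ B x u) ∧
        eLpNorm (fun s => S.toState μ (S.mildSolution μ B x u s)) q (volume.restrict (Icc 0 t)) ≤
          c₁ * ‖x‖ₑ + c₂ * eLpNorm u q (volume.restrict (Icc 0 t)) := by
    intro t x u hu
    obtain ⟨hex, hmeas, hle⟩ := hK.convolution_estimate hω hα hC hq hq' hu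
    obtain ⟨hSm, hSle, hfin⟩ := memLp_apply_of_norm_le hω₁ hSt hq hq' (t := t) x
    have heq : ∀ᵐ s ∂(volume.restrict (Icc 0 t)), S.mildSolution μ B x u s =
        S.toExtrapolation μ (S s x + ∫ r in (0 : ℝ)..s, K (s - r) (u r)) := by
      filter_upwards [hex, ae_restrict_mem measurableSet_Icc] with s hs hs'
      exact hK.mildSolution_eq hs'.1 hs x
    have heq' : (fun s => S.toState μ (S.mildSolution μ B x u s)) =ᵐ[volume.restrict (Icc 0 t)]
        fun s => S s x + ∫ r in (0 : ℝ)..s, K (s - r) (u r) := by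
      filter_upwards [heq] with s hs
      rw [hs, toState_toExtrapolation hμ]
    have hwm : MemLp (fun s => ∫ r in (0 : ℝ)..s, K (s - r) (u r)) q
        (volume.restrict (Icc 0 t)) :=
      ⟨hmeas, hle.trans_lt (ENNReal.mul_lt_top ENNReal.ofReal_lt_top hu.2)⟩
    refine ⟨⟨?_, (hSm.add hwm).ae_eq heq'.symm⟩, ?_⟩
    · filter_upwards [heq] with s hs
      rw [hs]
      exact ⟨_, rfl⟩
    · rw [eLpNorm_congr_ae heq']
      refine (eLpNorm_add_le hSm.1 hwm.1 hq).trans (add_le_add ?_ hle)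
      rwa [hc₁, ENNReal.coe_toNNReal hfin]
  have hzero : S.mildSolution μ B 0 = S.inputMap μ B := by
    funext u τ
    simp [mildSolution]
  refine ⟨fun t _ u hu => ?_, fun r => (c₁ + 1) * r, fun r => (c₂ + 1) * r,
    isClassKInfty_const_mul (by positivity), isClassKInfty_const_mul (by positivity),
    fun t _ x u hu => ⟨(hstate t x u hu).1, (hstate t x u hu).2.trans ?_⟩⟩
  · have := (hstate t 0 u hu).1
    rwa [hzero] at this
  · push_cast
    rw [ENNReal.coe_toNNReal hu.2.ne]
    gcongr
    · exact le_self_add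
    · exact le_rfl
    · exact le_self_add

end C0Semigroup

/-! ### The Lyapunov function -/

theorem add_pow_eq_pow_add_sum (a b : ℝ) (n : ℕ) :
    (a + b) ^ n = a ^ n +
      ∑ j ∈ Finset.range n, (n.choose (j + 1) : ℝ) * a ^ (n - (j + 1)) * b ^ (j + 1) := by
  rw [add_comm a b, add_pow, Finset.sum_range_succ', add_comm]
  congr 1
  · simp
  · exact Finset.sum_congr rfl fun j _ => by ring

/-- A case of Young's inequality for products, with an explicit constant. -/
theorem mul_pow_mul_le_half_pow_add {c a v : ℝ} (hc : 0 ≤ c) (ha : 0 ≤ a) (hv : 0 ≤ v) {n : ℕ}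
    (hn : 1 ≤ n) :
    c * a ^ (n - 1) * v ≤ 1 / 2 * a ^ n + c * (2 * c) ^ (n - 1) * v ^ n := by
  obtain ⟨m, rfl⟩ := Nat.exists_eq_add_of_le' hn
  rw [Nat.add_sub_cancel]
  rcases le_total (c * v) (a / 2) with h | h
  · have h1 : c * a ^ m * v ≤ 1 / 2 * a ^ (m + 1) := by
      calc c * a ^ m * v = a ^ m * (c * v) := by ring
        _ ≤ a ^ m * (a / 2) := by gcongr
        _ = _ := by ring
    have h2 : 0 ≤ c * (2 * c) ^ m * v ^ (m + 1) := by positivity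
    linarith
  · have h1 : c * a ^ m * v ≤ c * (2 * c) ^ m * v ^ (m + 1) := by
      calc c * a ^ m * v ≤ c * (2 * c * v) ^ m * v := by
            gcongr
            linarith
        _ = _ := by rw [mul_pow]; ring
    have h2 : 0 ≤ 1 / 2 * a ^ (m + 1) := by positivity
    linarith

namespace C0Semigroup

variable {X : Type*} [NormedAddCommGroup X] [NormedSpace ℂ X] {S : C0Semigroup X}

section Orbit

variable {M ω : ℝ}

theorem norm_apply_le_mul_exp (hSt : ∀ t : ℝ, 0 ≤ t → ‖S t‖ ≤ M * Real.exp (-ω * t)) {t : ℝ}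
    (ht : 0 ≤ t) (x : X) : ‖S t x‖ ≤ M * ‖x‖ * Real.exp (-ω * t) :=
  calc ‖S t x‖ ≤ M * Real.exp (-ω * t) * ‖x‖ := ContinuousLinearMap.le_of_opNorm_le _ (hSt t ht) x
    _ = _ := by ring

theorem exp_neg_mul_le_one (hω : 0 < ω) {t : ℝ} (ht : 0 ≤ t) : Real.exp (-ω * t) ≤ 1 :=
  Real.exp_le_one_iff.2 (by nlinarith)

theorem norm_apply_le_mul (hM : 0 < M) (hω : 0 < ω)
    (hSt : ∀ t : ℝ, 0 ≤ t → ‖S t‖ ≤ M * Real.exp (-ω * t)) {t : ℝ}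
    (ht : 0 ≤ t) (x : X) : ‖S t x‖ ≤ M * ‖x‖ :=
  (norm_apply_le_mul_exp hSt ht x).trans
    (mul_le_of_le_one_right (by positivity) (exp_neg_mul_le_one hω ht))

theorem norm_apply_pow_le (hM : 0 < M) (hω : 0 < ω)
    (hSt : ∀ t : ℝ, 0 ≤ t → ‖S t‖ ≤ M * Real.exp (-ω * t)) {n : ℕ} (hn : 1 ≤ n) {t : ℝ}
    (ht : 0 ≤ t) (x : X) : ‖S t x‖ ^ n ≤ (M * ‖x‖) ^ n * Real.exp (-ω * t) :=
  calc ‖S t x‖ ^ n ≤ (M * ‖x‖ * Real.exp (-ω * t)) ^ n := by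
        gcongr
        exact norm_apply_le_mul_exp hSt ht x
    _ = (M * ‖x‖) ^ n * Real.exp (-ω * t) ^ n := mul_pow _ _ _
    _ ≤ _ := by
      gcongr
      exact pow_le_of_le_one (Real.exp_pos _).le (exp_neg_mul_le_one hω ht) (by lia)

theorem continuousOn_norm_apply_pow (S : C0Semigroup X) (x : X) (n : ℕ) :
    ContinuousOn (fun t : ℝ => ‖S t x‖ ^ n) (Ici 0) :=
  (S.continuousOn' x).norm.pow n

theorem integrableOn_norm_apply_pow (hM : 0 < M) (hω : 0 < ω)
    (hSt : ∀ t : ℝ, 0 ≤ t → ‖S t‖ ≤ M * Real.exp (-ω * t)) {n : ℕ} (hn : 1 ≤ n) (x : X) :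
    IntegrableOn (fun t : ℝ => ‖S t x‖ ^ n) (Ioi 0) := by
  refine Integrable.mono' ((exp_neg_integrableOn_Ioi 0 hω).const_mul ((M * ‖x‖) ^ n))
    (((S.continuousOn_norm_apply_pow x n).mono Ioi_subset_Ici_self).aestronglyMeasurable
      measurableSet_Ioi) ?_
  filter_upwards [ae_restrict_mem measurableSet_Ioi] with t ht
  rw [Real.norm_of_nonneg (by positivity)]
  exact norm_apply_pow_le hM hω hSt hn (le_of_lt ht) x

theorem orbitIntegral_nonneg (S : C0Semigroup X) (n : ℕ) (x : X) : 0 ≤ S.orbitIntegral n x :=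
  integral_nonneg fun t => by positivity

theorem orbitIntegral_le (hM : 0 < M) (hω : 0 < ω)
    (hSt : ∀ t : ℝ, 0 ≤ t → ‖S t‖ ≤ M * Real.exp (-ω * t)) {n : ℕ} (hn : 1 ≤ n) (x : X) :
    S.orbitIntegral n x ≤ (M * ‖x‖) ^ n * ∫ t in Ioi (0 : ℝ), Real.exp (-ω * t) := by
  rw [← integral_const_mul]
  refine setIntegral_mono_on (integrableOn_norm_apply_pow hM hω hSt hn x)
    ((exp_neg_integrableOn_Ioi 0 hω).const_mul _) measurableSet_Ioi fun t ht => ?_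
  exact norm_apply_pow_le hM hω hSt hn (le_of_lt ht) x

theorem orbitIntegral_pos (hM : 0 < M) (hω : 0 < ω)
    (hSt : ∀ t : ℝ, 0 ≤ t → ‖S t‖ ≤ M * Real.exp (-ω * t)) {n : ℕ} (hn : 1 ≤ n) {x : X}
    (hx : x ≠ 0) : 0 < S.orbitIntegral n x := by
  rw [orbitIntegral, setIntegral_pos_iff_support_of_nonneg_ae (.of_forall fun t => by positivity)
    (integrableOn_norm_apply_pow hM hω hSt hn x)]
  have hc : ContinuousWithinAt (fun t : ℝ => S t x) (Ici 0) 0 := S.continuousOn' x 0 self_mem_Ici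
  have hev : ∀ᶠ t in 𝓝[≥] (0 : ℝ), S t x ≠ 0 := by
    refine hc.eventually_ne ?_
    simpa only [S.apply_zero] using hx
  obtain ⟨δ, hδ, hδ'⟩ := mem_nhdsGE_iff_exists_Ico_subset.1 hev
  have hsub : Ioo 0 δ ⊆ Function.support (fun t : ℝ => ‖S t x‖ ^ n) ∩ Ioi 0 := fun t ht =>
    ⟨pow_ne_zero _ (norm_ne_zero_iff.2 (hδ' ⟨ht.1.le, ht.2⟩)), ht.1⟩
  refine lt_of_lt_of_le ?_ (measure_mono hsub)
  rw [Real.volume_Ioo, ENNReal.ofReal_pos]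
  simpa using hδ

theorem orbitIntegral_smul (S : C0Semigroup X) (n : ℕ) (a : ℝ) (x : X) :
    S.orbitIntegral n (a • x) = |a| ^ n * S.orbitIntegral n x := by
  rw [orbitIntegral, orbitIntegral, ← integral_const_mul]
  refine integral_congr_ae (.of_forall fun t => ?_)
  have h : S t (a • x) = a • S t x := (S t).toLinearMap.map_smul_of_tower a x
  simp only [h, norm_smul, Real.norm_eq_abs, mul_pow]

theorem locallyLipschitz_orbitIntegral (hM : 0 < M) (hω : 0 < ω)
    (hSt : ∀ t : ℝ, 0 ≤ t → ‖S t‖ ≤ M * Real.exp (-ω * t)) {n : ℕ} (hn : 1 ≤ n) :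
    LocallyLipschitz (S.orbitIntegral n) := by
  intro x₀
  set R : ℝ := ‖x₀‖ + 1 with hR
  set c : ℝ := M * n * (M * R) ^ (n - 1) with hc
  have hR0 : 0 < R := by positivity
  set I : ℝ := ∫ t in Ioi (0 : ℝ), Real.exp (-ω * t) with hI
  have hI0 : 0 ≤ I := integral_nonneg fun t => (Real.exp_pos _).le
  have hnorm : ∀ x ∈ Metric.ball x₀ 1, ‖x‖ ≤ R := fun x hx => by
    have h1 : ‖x - x₀‖ < 1 := by simpa [dist_eq_norm] using hx
    have h2 := norm_add_le x₀ (x - x₀)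
    rw [add_sub_cancel] at h2
    linarith
  refine ⟨(c * I).toNNReal, Metric.ball x₀ 1, Metric.ball_mem_nhds _ one_pos,
    LipschitzOnWith.of_dist_le_mul fun x hx y hy => ?_⟩
  rw [Real.coe_toNNReal _ (by positivity), Real.dist_eq, dist_eq_norm, orbitIntegral, orbitIntegral,
    ← integral_sub (integrableOn_norm_apply_pow hM hω hSt hn x)
      (integrableOn_norm_apply_pow hM hω hSt hn y), ← Real.norm_eq_abs]
  have hle : ∀ t ∈ Ioi (0 : ℝ), ‖‖S t x‖ ^ n - ‖S t y‖ ^ n‖ ≤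
      c * ‖x - y‖ * Real.exp (-ω * t) := by
    intro t ht
    have ht0 : 0 ≤ t := le_of_lt ht
    have hmax : max |‖S t x‖| |‖S t y‖| ≤ M * R := by
      rw [abs_norm, abs_norm]
      refine max_le ?_ ?_
      · exact (norm_apply_le_mul hM hω hSt ht0 x).trans (by gcongr; exact hnorm x hx)
      · exact (norm_apply_le_mul hM hω hSt ht0 y).trans (by gcongr; exact hnorm y hy)
    have hdiff : |‖S t x‖ - ‖S t y‖| ≤ M * ‖x - y‖ * Real.exp (-ω * t) := by
      refine (abs_norm_sub_norm_le _ _).trans ?_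
      rw [← _root_.map_sub]
      exact norm_apply_le_mul_exp hSt ht0 _
    rw [Real.norm_eq_abs]
    calc |‖S t x‖ ^ n - ‖S t y‖ ^ n|
        ≤ |‖S t x‖ - ‖S t y‖| * n * max |‖S t x‖| |‖S t y‖| ^ (n - 1) := abs_pow_sub_pow_le _ _ _
      _ ≤ M * ‖x - y‖ * Real.exp (-ω * t) * n * (M * R) ^ (n - 1) := by gcongr
      _ = _ := by rw [hc]; ring
  refine (norm_integral_le_of_norm_le ((exp_neg_integrableOn_Ioi 0 hω).const_mul _)
    (ae_restrict_of_forall_mem measurableSet_Ioi hle)).trans (le_of_eq ?_)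
  rw [integral_const_mul]
  ring

theorem orbitIntegral_apply (hM : 0 < M) (hω : 0 < ω)
    (hSt : ∀ t : ℝ, 0 ≤ t → ‖S t‖ ≤ M * Real.exp (-ω * t)) {n : ℕ} (hn : 1 ≤ n) {t : ℝ}
    (ht : 0 ≤ t) (x : X) :
    S.orbitIntegral n (S t x) = S.orbitIntegral n x - ∫ s in Ioc 0 t, ‖S s x‖ ^ n := by
  have hi := integrableOn_norm_apply_pow hM hω hSt hn x
  have h1 : S.orbitIntegral n x =
      (∫ s in Ioc 0 t, ‖S s x‖ ^ n) + ∫ s in Ioi t, ‖S s x‖ ^ n := by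
    rw [orbitIntegral, ← Ioc_union_Ioi_eq_Ioi ht]
    exact setIntegral_union (Ioc_disjoint_Ioi le_rfl) measurableSet_Ioi
      (hi.mono_set Ioc_subset_Ioi_self) (hi.mono_set (Ioi_subset_Ioi ht))
  have h2 := (measurePreserving_add_right volume t).setIntegral_preimage_emb
    (measurableEmbedding_addRight t) (fun s => ‖S s x‖ ^ n) (Ioi t)
  rw [preimage_add_const_Ioi, sub_self] at h2
  rw [h1, ← h2, add_sub_cancel_left, orbitIntegral]
  refine setIntegral_congr_fun measurableSet_Ioi fun s hs => ?_
  rw [S.apply_add (le_of_lt hs) ht]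

/-- The effect on `V` of a perturbation `w` whose orbit is dominated by `ρ t ^ (-α) e ^ (-ω t)`:
the binomial expansion of `(‖T(t) y‖ + ‖T(t) w‖) ^ n`, integrated term by term. The `n`-th power
of the dominating function is integrable because `n α < 1`. -/
theorem orbitIntegral_add_le (hM : 0 < M) (hω : 0 < ω)
    (hSt : ∀ t : ℝ, 0 ≤ t → ‖S t‖ ≤ M * Real.exp (-ω * t)) {n : ℕ} (hn : 1 ≤ n) {α ω' A ρ : ℝ}
    (hω' : 0 < ω') (hα : 0 ≤ α) (hnα : (n : ℝ) * α < 1) {y w : X}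
    (hy : ∀ s : ℝ, 0 < s → ‖S s y‖ ≤ A)
    (hw : ∀ s : ℝ, 0 < s → ‖S s w‖ ≤ ρ * kernelBound α ω' s) :
    S.orbitIntegral n (y + w) ≤ S.orbitIntegral n y +
      ∑ j ∈ Finset.range n, (n.choose (j + 1) : ℝ) * A ^ (n - (j + 1)) * ρ ^ (j + 1) *
        ∫ s in Ioi (0 : ℝ), kernelBound α ω' s ^ (j + 1) := by
  have hA : 0 ≤ A := (norm_nonneg _).trans (hy 1 one_pos)
  have hterm : ∀ j ∈ Finset.range n, IntegrableOn (fun s => (n.choose (j + 1) : ℝ) *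
      A ^ (n - (j + 1)) * ρ ^ (j + 1) * kernelBound α ω' s ^ (j + 1)) (Ioi 0) := fun j hj => by
    refine Integrable.const_mul (integrableOn_kernelBound_pow hω' (Nat.succ_pos j) ?_) _
    have : ((j + 1 : ℕ) : ℝ) ≤ n := by exact_mod_cast Finset.mem_range.1 hj
    exact (mul_le_mul_of_nonneg_right this hα).trans_lt hnα
  have hsum := integrable_finsetSum _ hterm
  have hi := integrableOn_norm_apply_pow hM hω hSt hn y
  have hrhs : S.orbitIntegral n y +
      ∑ j ∈ Finset.range n, (n.choose (j + 1) : ℝ) * A ^ (n - (j + 1)) * ρ ^ (j + 1) *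
        ∫ s in Ioi (0 : ℝ), kernelBound α ω' s ^ (j + 1) =
      ∫ s in Ioi (0 : ℝ), (‖S s y‖ ^ n + ∑ j ∈ Finset.range n, (n.choose (j + 1) : ℝ) *
        A ^ (n - (j + 1)) * ρ ^ (j + 1) * kernelBound α ω' s ^ (j + 1)) := by
    rw [integral_add hi hsum, integral_finsetSum _ hterm, orbitIntegral]
    congr 1
    exact Finset.sum_congr rfl fun j _ => (integral_const_mul _ _).symm
  rw [hrhs]
  refine setIntegral_mono_on (integrableOn_norm_apply_pow hM hω hSt hn _) (hi.add hsum)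
    measurableSet_Ioi fun s hs => ?_
  have hs0 : 0 < s := hs
  calc ‖S s (y + w)‖ ^ n ≤ (‖S s y‖ + ‖S s w‖) ^ n := by
        gcongr
        rw [_root_.map_add]
        exact norm_add_le _ _
    _ = ‖S s y‖ ^ n + ∑ j ∈ Finset.range n, (n.choose (j + 1) : ℝ) *
        ‖S s y‖ ^ (n - (j + 1)) * ‖S s w‖ ^ (j + 1) := add_pow_eq_pow_add_sum _ _ _
    _ ≤ _ := by
      refine add_le_add le_rfl (Finset.sum_le_sum fun j _ => ?_)
      rw [mul_assoc _ (ρ ^ (j + 1)), ← mul_pow]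
      have h1 := hy s hs0
      have h2 := hw s hs0
      gcongr

end Orbit

variable {U : Type*} [NormedAddCommGroup U] [NormedSpace ℝ U]

namespace IsInputKernel

variable {μ : ℂ} {B : U →L[ℝ] S.Extrapolation μ} {α ω' C : ℝ} {K : ℝ → U →L[ℝ] X}

/-- `T(s) Φ_t u` is small with `t`, uniformly up to the factor `s ^ (-α) e ^ (-ω s)`. -/
theorem norm_apply_integral_le [CompleteSpace X] (hK : S.IsInputKernel μ B α ω' C K) (hω : 0 < ω')
    (hα₀ : 0 ≤ α) (hC : 0 ≤ C) {u : ℝ → U} {t R : ℝ} (ht : 0 ≤ t)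
    (hi : IntervalIntegrable (fun r => K (t - r) (u r)) volume 0 t)
    (hR : ∀ r ∈ Icc 0 t, ‖u r‖ ≤ R) {s : ℝ} (hs : 0 < s) :
    ‖S s (∫ r in (0 : ℝ)..t, K (t - r) (u r))‖ ≤ t * (R * C) * kernelBound α ω' s := by
  have hR0 : 0 ≤ R := (norm_nonneg _).trans (hR 0 (left_mem_Icc.2 ht))
  have hk := kernelBound_nonneg (α := α) (ω := ω') hs.le
  rw [← (S s).intervalIntegral_comp_comm hi]
  have h := intervalIntegral.norm_integral_le_of_norm_le_const_ae (a := 0) (b := t)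
    (f := fun r => S s (K (t - r) (u r))) (C := C * kernelBound α ω' s * R) ?_
  · refine h.trans (le_of_eq ?_)
    rw [sub_zero, abs_of_nonneg ht]
    ring
  · -- The integrand is controlled except at `r = t`, where `K 0` is meaningless.
    filter_upwards [Measure.ae_ne volume t] with r hrt hr
    rw [uIoc_of_le ht] at hr
    have hr1 : 0 < t - r := sub_pos.2 (lt_of_le_of_ne hr.2 hrt)
    rw [← hK.add_apply s (t - r) hs.le hr1]
    refine (ContinuousLinearMap.le_opNorm _ _).trans ?_
    refine mul_le_mul ((hK.norm_le _ (by linarith)).trans ?_) (hR r ⟨hr.1.le, hr.2⟩)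
      (norm_nonneg _) (by positivity)
    gcongr
    exact kernelBound_anti hα₀ hω.le hs (by linarith)

/-- The dissipation inequality. The free motion contributes `-‖x‖ ^ n` to the Lie derivative, and
by `orbitIntegral_add_le` the input contributes only its term of first order in `t`, which is
`n (M ‖x‖) ^ (n - 1) C ‖k‖_1 ‖u(0)‖`. -/
theorem lieDerivative_le [CompleteSpace X] (hμ : μ ∈ S.resolventSet)
    (hK : S.IsInputKernel μ B α ω' C K) (hω' : 0 < ω') (hα₀ : 0 ≤ α) (hα₁ : α < 1) (hC : 0 ≤ C)
    {M ω : ℝ} (hM : 0 < M) (hω : 0 < ω) (hSt : ∀ t : ℝ, 0 ≤ t → ‖S t‖ ≤ M * Real.exp (-ω * t))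
    {n : ℕ} (hn : 1 ≤ n) (hnα : (n : ℝ) * α < 1) (x : X) {u : ℝ → U}
    (hu : ContinuousOn u (Ici 0)) :
    S.lieDerivative μ B (S.orbitIntegral n) u x ≤
      ((-‖x‖ ^ n + n * (M * ‖x‖) ^ (n - 1) * (‖u 0‖ * C) *
        ∫ s in Ioi (0 : ℝ), kernelBound α ω' s : ℝ) : EReal) := by
  set κ : ℕ → ℝ := fun j => ∫ s in Ioi (0 : ℝ), kernelBound α ω' s ^ j with hκ
  have hκ0 : ∀ j, 0 ≤ κ j := fun j => setIntegral_nonneg measurableSet_Ioi fun s hs =>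
    pow_nonneg (kernelBound_nonneg (le_of_lt hs)) j
  -- `Q t R` bounds the contribution of an input of size `R` on `[0, t]` to the difference quotient.
  set Q : ℝ → ℝ → ℝ := fun t R => ∑ j ∈ Finset.range n, (n.choose (j + 1) : ℝ) *
    (M * ‖x‖) ^ (n - (j + 1)) * (t ^ j * (R * C) ^ (j + 1)) * κ (j + 1) with hQ
  have hQ0 : Q 0 ‖u 0‖ = n * (M * ‖x‖) ^ (n - 1) * (‖u 0‖ * C) *
      ∫ s in Ioi (0 : ℝ), kernelBound α ω' s := by
    simp only [hQ]
    rw [Finset.sum_eq_single_of_mem 0 (Finset.mem_range.2 (by lia))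
      fun j _ hj => by rw [zero_pow hj]; ring]
    simp [hκ]
  rw [← hQ0]
  refine EReal.le_of_forall_lt_iff_le.1 fun z hz => limsup_le_of_le ?_ ?_
  · isBoundedDefault
  have hz' : -‖x‖ ^ n + Q 0 ‖u 0‖ < z := by exact_mod_cast hz
  obtain ⟨ε, hε, hεz⟩ : ∃ ε : ℝ, 0 < ε ∧ -‖x‖ ^ n + ε + Q ε (‖u 0‖ + ε) < z := by
    have hcont : Continuous fun ε : ℝ => -‖x‖ ^ n + ε + Q ε (‖u 0‖ + ε) := by
      simp only [hQ]
      fun_prop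
    have h1 : ∀ᶠ ε in 𝓝 (0 : ℝ), -‖x‖ ^ n + ε + Q ε (‖u 0‖ + ε) < z :=
      hcont.continuousAt.eventually_lt_const (by simpa using hz')
    obtain ⟨ε, h2, h3⟩ := ((h1.filter_mono nhdsWithin_le_nhds).and
      (self_mem_nhdsWithin : ∀ᶠ ε in 𝓝[>] (0 : ℝ), ε ∈ Ioi (0 : ℝ))).exists
    exact ⟨ε, h3, h2⟩
  have hu0 : ∀ᶠ r in 𝓝[≥] (0 : ℝ), ‖u r‖ < ‖u 0‖ + ε :=
    (hu 0 self_mem_Ici).norm.eventually_lt_const (by linarith)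
  have hx0 : ∀ᶠ r in 𝓝[≥] (0 : ℝ), ‖x‖ ^ n - ε < ‖S r x‖ ^ n :=
    (S.continuousOn_norm_apply_pow x n 0 self_mem_Ici).eventually_const_lt
      (by simp only [S.apply_zero]; linarith)
  obtain ⟨δ, hδ, hδ'⟩ := mem_nhdsGE_iff_exists_Ico_subset.1 (hu0.and hx0)
  have hδ0 : 0 < δ := hδ
  filter_upwards [Ioo_mem_nhdsGT (lt_min hδ0 hε)] with t ht
  have ht0 : 0 < t := ht.1
  have htδ : t < δ := ht.2.trans_le (min_le_left _ _)
  have htε : t ≤ ε := ht.2.le.trans (min_le_right _ _)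
  have hut : ContinuousOn u (Icc 0 t) := hu.mono Icc_subset_Ici_self
  have hi := hK.intervalIntegrable_of_continuousOn hω' hα₁ ht0.le hut
  rw [hK.mildSolution_eq ht0.le hi, toState_toExtrapolation hμ]
  have hw : ∀ s : ℝ, 0 < s → ‖S s (∫ r in (0 : ℝ)..t, K (t - r) (u r))‖ ≤
      t * ((‖u 0‖ + ε) * C) * kernelBound α ω' s := fun s hs =>
    hK.norm_apply_integral_le hω' hα₀ hC ht0.le hi
      (fun r hr => (hδ' ⟨hr.1, hr.2.trans_lt htδ⟩).1.le) hs
  have hy : ∀ s : ℝ, 0 < s → ‖S s (S t x)‖ ≤ M * ‖x‖ := fun s hs => by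
    rw [← S.apply_add hs.le ht0.le]
    exact norm_apply_le_mul hM hω hSt (by linarith) x
  have hV := orbitIntegral_add_le hM hω hSt hn hω' hα₀ hnα hy hw
  have hsum : (∑ j ∈ Finset.range n, (n.choose (j + 1) : ℝ) * (M * ‖x‖) ^ (n - (j + 1)) *
      (t * ((‖u 0‖ + ε) * C)) ^ (j + 1) * ∫ s in Ioi (0 : ℝ), kernelBound α ω' s ^ (j + 1)) =
      t * Q t (‖u 0‖ + ε) := by
    simp only [hQ, hκ]
    rw [Finset.mul_sum]
    refine Finset.sum_congr rfl fun j _ => ?_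
    rw [mul_pow t, pow_succ t]
    ring
  have hQmono : Q t (‖u 0‖ + ε) ≤ Q ε (‖u 0‖ + ε) := by
    simp only [hQ]
    gcongr with j hj
    exact hκ0 _
  have hfree : t * (‖x‖ ^ n - ε) ≤ ∫ s in Ioc 0 t, ‖S s x‖ ^ n := by
    have h1 : ∫ _ in Ioc 0 t, (‖x‖ ^ n - ε) = t * (‖x‖ ^ n - ε) := by
      rw [setIntegral_const, smul_eq_mul, Real.volume_real_Ioc_of_le ht0.le, sub_zero]
    rw [← h1]
    refine setIntegral_mono_on (integrableOn_const (by simp))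
      ((integrableOn_norm_apply_pow hM hω hSt hn x).mono_set Ioc_subset_Ioi_self)
      measurableSet_Ioc fun s hs => ?_
    exact (hδ' ⟨hs.1.le, hs.2.trans_lt htδ⟩).2.le
  rw [hsum, orbitIntegral_apply hM hω hSt hn ht0.le] at hV
  rw [EReal.coe_le_coe_iff, div_le_iff₀ ht0]
  have h2 : t * Q t (‖u 0‖ + ε) ≤ t * Q ε (‖u 0‖ + ε) := by gcongr
  nlinarith

theorem isNoncoerciveISSLyapunov [CompleteSpace X] (hμ : μ ∈ S.resolventSet)
    (hK : S.IsInputKernel μ B α ω' C K) (hω' : 0 < ω') (hα₀ : 0 ≤ α) (hα₁ : α < 1) (hC : 0 ≤ C)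
    (hS : S.IsExponentiallyStable) {n : ℕ} (hn : 1 ≤ n) (hnα : (n : ℝ) * α < 1) :
    S.IsNoncoerciveISSLyapunov μ B n (S.orbitIntegral n) := by
  obtain ⟨M, ω, hM, hω, hSt⟩ := hS
  set κ : ℝ := ∫ s in Ioi (0 : ℝ), kernelBound α ω' s with hκ
  have hκ0 : 0 ≤ κ := setIntegral_nonneg measurableSet_Ioi fun s hs =>
    kernelBound_nonneg (le_of_lt hs)
  set I : ℝ := ∫ t in Ioi (0 : ℝ), Real.exp (-ω * t) with hI
  have hI0 : 0 ≤ I := integral_nonneg fun t => (Real.exp_pos _).le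
  set c : ℝ := n * M ^ (n - 1) * C * κ with hc
  have hc0 : 0 ≤ c := by positivity
  refine ⟨hK.isCAdmissible hω' hα₁, (locallyLipschitz_orbitIntegral hM hω hSt hn).continuous,
    S.orbitIntegral_nonneg n, fun a x => ?_, M ^ n * I + 1, 1 / 2, c * (2 * c) ^ (n - 1) + 1,
    by positivity, by positivity, by positivity, fun x hx => ⟨orbitIntegral_pos hM hω hSt hn hx, ?_⟩,
    fun x u hu => ?_⟩
  · rw [Real.rpow_natCast, orbitIntegral_smul]
  · rw [Real.rpow_natCast]
    refine (orbitIntegral_le hM hω hSt hn x).trans ?_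
    rw [mul_pow, ← hI]
    have : 0 ≤ ‖x‖ ^ n := by positivity
    linarith
  · refine (hK.lieDerivative_le hμ hω' hα₀ hα₁ hC hM hω hSt hn hnα x hu).trans ?_
    rw [EReal.coe_le_coe_iff, Real.rpow_natCast, Real.rpow_natCast, ← hκ]
    have h := mul_pow_mul_le_half_pow_add hc0 (norm_nonneg x) (norm_nonneg (u 0)) hn
    have e : n * (M * ‖x‖) ^ (n - 1) * (‖u 0‖ * C) * κ = c * ‖x‖ ^ (n - 1) * ‖u 0‖ := by
      rw [hc, mul_pow]
      ring
    have : 0 ≤ ‖u 0‖ ^ n := by positivity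
    rw [e]
    linarith

end IsInputKernel

end C0Semigroup

theorem mainTheorem5
    {X : Type*} [NormedAddCommGroup X] [NormedSpace ℂ X] [CompleteSpace X]
    {U : Type*} [NormedAddCommGroup U] [NormedSpace ℝ U] [CompleteSpace U]
    (S : C0Semigroup X) (hstable : S.IsExponentiallyStable) (hanalytic : S.IsAnalytic)
    (μ : ℂ) (hμ : μ ∈ S.resolventSet)
    (B : U →L[ℝ] S.Extrapolation μ)
    (α : ℝ) (hα₀ : 0 ≤ α) (hα₁ : α < 1) (hB : S.MapsBoundedlyInto μ α B) :
    (∀ n : ℕ, 1 ≤ n → (n : ℝ) * α < 1 →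
      (∀ x : X, IntegrableOn (fun t : ℝ => ‖S t x‖ ^ n) (Ioi 0)) ∧
      LocallyLipschitz (S.orbitIntegral n) ∧
      S.IsNoncoerciveISSLyapunov μ B n (S.orbitIntegral n)) ∧
    ∀ q : ℝ≥0∞, 1 ≤ q → q ≠ ∞ → S.IsLpLqISS μ B q q := by
  obtain ⟨ω', C, K, hω', hC, hK⟩ := hanalytic.exists_isInputKernel hstable hμ hα₀ hα₁ hB
  obtain ⟨M, ω, hM, hω, hSt⟩ := id hstable
  exact ⟨fun n hn hnα => ⟨C0Semigroup.integrableOn_norm_apply_pow hM hω hSt hn,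
    C0Semigroup.locallyLipschitz_orbitIntegral hM hω hSt hn,
    hK.isNoncoerciveISSLyapunov hμ hω' hα₀ hα₁ hC.le hstable hn hnα⟩,
    fun q hq hq' => hK.isLpLqISS hμ hω' hα₁ hC.le hstable hq hq'⟩
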